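/- Let $\phi_G$ be the standard Gaussian density, let $\mathbb{P}_f$ denote the law of an i.i.d. sample $X_1,\dots,X_n$ with common density $f$, and let $\mathcal{F}_0=\{\phi_G(\cdot-\mu):\mu\in\mathbb{R}\}$. A level-$\alpha$ test is a measurable $\{0,1\}$-valued function $T$ of $(X_1,\dots,X_n)$ with $\sup_{f\in\mathcal{F}_0}\mathbb{P}_f(T=1)\le\alpha$. For $n\ge 2$ let $X_{(1)}\le\dots\le X_{(n)}$ be the order statistics, $\mathcal{K}_n=\{2^j:0\le j\le\lfloor\log_2(n/2)\rfloor\}$, let $q_{u,k}$ be the $(1-u)$-quantile of $X_{(n-k+1)}-X_{(k)}$ under $\mathcal{F}_0$ (the law of this spacing does not depend on $\mu$), and $$\alpha_n=\sup\{u\in(0,1):\ \mathbb{P}_{\phi_G}(\exists k\in\mathcal{K}_n,\ X_{(n-k+1)}-X_{(k)}>q_{u,k})\le\alpha\}.$$ Put $$\Psi_\alpha=\sup_{k\in\mathcal{K}_n}\mathbf{1}_{\{X_{(n-k+1)}-X_{(k)}>q_{\alpha_n,k}\}},\qquad \psi_\alpha=\mathbf{1}_{\{S_n^2>v_{\alpha,n}\}},\qquad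 S_n^2=\frac1{n-1}\sum_{i=1}^n(X_i-\bar X_n)^2,$$ where $v_{\alpha,n}$ is the $(1-\alpha)$-quantile of $S_n^2$ under $\mathcal{F}_0$. Let $\alpha\in(0,1)$, $\beta\in(0,1-\alpha)$, $0<\delta\le\frac12$, $0<r<\frac12$, and $r^*(\delta)=\frac14-\frac\delta2$. Consider sequences $\varepsilon_n\in(0,1)$ and $\mu_{1,n}<\mu_{2,n}$ with $\varepsilon_n\sim n^{-\delta}$ and $\mu_{2,n}-\mu_{1,n}\sim n^{-r}$ as $n\to\infty$ (where $a_n\sim b_n$ means $a_n/b_n\to1$), and set $f_n=(1-\varepsilon_n)\phi_G(\cdot-\mu_{1,n})+\varepsilon_n\phi_G(\cdot-\mu_{2,n})$. Then $r^*(\delta)$ is the detection boundary, in the following sense. 1. (Detection is possible for $r<r^*(\delta)$.) For every $n\ge2$, $\Psi_\alpha$ and $\psi_\alpha$ are level-$\alpha$ tests, and if $r<r^*(\delta)$, then for all $n$ large enough $\mathbb{P}_{f_n}(\Psi_\alpha=0)\le\beta$ and $\mathbb{P}_{f_n}(\psi_\alpha=0)\le\beta$. 2. (Detection is impossible for $r>r^*(\delta)$.)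 If $r>r^*(\delta)$, then for all $n$ large enough every level-$\alpha$ test $T$ based on $X_1,\dots,X_n$ satisfies $\mathbb{P}_{f_n}(T=0)>\beta$. -/

import Mathlib

open MeasureTheory ProbabilityTheory Filter Topology

noncomputable section

namespace MixtureDetection

/-- The law `P_f` of `n` i.i.d. real random variables with common density `f`. -/
def sampleLaw (f : ℝ → ℝ) (n : ℕ) : Measure (Fin n → ℝ) :=
  Measure.pi fun _ : Fin n => (volume : Measure ℝ).withDensity fun x => ENNReal.ofReal (f x)

/-- The standard Gaussian density. -/
def gaussDensity : ℝ → ℝ := gaussianPDFReal 0 1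

/-- The null hypothesis: all translates of `φ`. -/
def nullSet (φ : ℝ → ℝ) : Set (ℝ → ℝ) :=
  {f | ∃ μ : ℝ, f = fun x => φ (x - μ)}

/-- The two-component mixture density `(1 - ε) φ(· - μ₁) + ε φ(· - μ₂)`. -/
def mixture (φ : ℝ → ℝ) (ε μ₁ μ₂ : ℝ) : ℝ → ℝ :=
  fun x => (1 - ε) * φ (x - μ₁) + ε * φ (x - μ₂)

/-- A level-`α` test based on `n` observations: a measurable `{0,1}`-valued function of the
sample whose first kind error is at most `α` under every density of the null hypothesis. -/
structure IsLevelTest (φ : ℝ → ℝ) (n : ℕ) (α : ℝ) (T : (Fin n → ℝ) → Fin 2) : Prop where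
  measurable : Measurable T
  level : ∀ f ∈ nullSet φ, (sampleLaw f n).real {x | T x = 1} ≤ α

/-- The second kind error `P_f(T = 0)` of a test `T` at the density `f`. -/
def secondKindError {n : ℕ} (f : ℝ → ℝ) (T : (Fin n → ℝ) → Fin 2) : ℝ :=
  (sampleLaw f n).real {x | T x = 0}

/-- The `p`-quantile of the statistic `Y` under `P`. -/
def quantile {Ω : Type*} [MeasurableSpace Ω] (P : Measure Ω) (Y : Ω → ℝ) (p : ℝ) : ℝ :=
  sInf {t : ℝ | p ≤ P.real {x | Y x ≤ t}}

/-- The order statistic `x_(k)`, for `1 ≤ k ≤ n` (the `k`-th smallest coordinate). -/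
def orderStat {n : ℕ} (x : Fin n → ℝ) (k : ℕ) : ℝ :=
  if h : 1 ≤ k ∧ k ≤ n then x (Tuple.sort x ⟨k - 1, by omega⟩) else 0

/-- The spacing `x_(n-k+1) - x_(k)`. -/
def spacing {n : ℕ} (k : ℕ) (x : Fin n → ℝ) : ℝ :=
  orderStat x (n - k + 1) - orderStat x k

/-- `K_n = {2^j : 0 ≤ j ≤ ⌊log₂(n/2)⌋}`. -/
def dyadicSet (n : ℕ) : Finset ℕ :=
  (Finset.range (⌊Real.logb 2 ((n : ℝ) / 2)⌋₊ + 1)).image fun j => 2 ^ j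

/-- `q_{u,k}`: the `(1-u)`-quantile of `X_(n-k+1) - X_(k)` under the null hypothesis. (This
spacing is translation invariant, so the mean under the null may be taken to be `0`.) -/
def spacingQuantile (φ : ℝ → ℝ) (n : ℕ) (u : ℝ) (k : ℕ) : ℝ :=
  quantile (sampleLaw φ n) (spacing k) (1 - u)

/-- The corrected level `α_n` of the individual spacing tests. -/
def correctedLevel (φ : ℝ → ℝ) (n : ℕ) (α : ℝ) : ℝ :=
  sSup {u : ℝ | u ∈ Set.Ioo (0 : ℝ) 1 ∧
    (sampleLaw φ n).real {x | ∃ k ∈ dyadicSet n, spacingQuantile φ n u k < spacing k x} ≤ α}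

/-- The multiple test `Ψ_α = sup_{k ∈ K_n} 1{X_(n-k+1) - X_(k) > q_{α_n,k}}`. -/
def orderTest (φ : ℝ → ℝ) (n : ℕ) (α : ℝ) : (Fin n → ℝ) → Fin 2 :=
  fun x => (dyadicSet n).sup fun k =>
    if spacingQuantile φ n (correctedLevel φ n α) k < spacing k x then (1 : Fin 2) else 0

/-- The empirical mean. -/
def empMean {n : ℕ} (x : Fin n → ℝ) : ℝ := (∑ i, x i) / (n : ℝ)

/-- The unbiased empirical variance `S_n²`. -/
def empVar {n : ℕ} (x : Fin n → ℝ) : ℝ :=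
  (∑ i, (x i - empMean x) ^ 2) / ((n : ℝ) - 1)

/-- The variance test `ψ_α = 1{S_n² > v_{α,n}}`, where `v_{α,n}` is the `(1-α)`-quantile of
`S_n²` under the null hypothesis. (`S_n²` is translation invariant, so the mean under the null
may be taken to be `0`.) -/
def varTest (φ : ℝ → ℝ) (n : ℕ) (α : ℝ) : (Fin n → ℝ) → Fin 2 :=
  fun x => if quantile (sampleLaw φ n) empVar (1 - α) < empVar x then 1 else 0

/-- The dense parametrization: `ε_n ~ n^{-δ}` and `μ₂ₙ - μ₁ₙ ~ n^{-r}`. -/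
structure DenseRegime (δ r : ℝ) (ε μ₁ μ₂ : ℕ → ℝ) : Prop where
  eps_mem : ∀ n, ε n ∈ Set.Ioo (0 : ℝ) 1
  mean_lt : ∀ n, μ₁ n < μ₂ n
  eps_equiv : Tendsto (fun n : ℕ => ε n / (n : ℝ) ^ (-δ)) atTop (𝓝 1)
  gap_equiv : Tendsto (fun n : ℕ => (μ₂ n - μ₁ n) / (n : ℝ) ^ (-r)) atTop (𝓝 1)

end MixtureDetection

end

/-! Write `Δ = μ₂ - μ₁`. A mixture differs from the single Gaussian with the same mean only at
second order: centring at the mean `μ₁ + εΔ` cancels the first-order effect and leaves the excess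
variance `ε(1-ε)Δ²`. In the dense regime this signal has order `n^{-(δ+2r)}`, while an i.i.d. sample
resolves scale `n^{-1/2}`. The two balance exactly at `r = 1/4 - δ/2`.

Impossibility: the `χ²` divergence of one observation of the mixture from `N(μ₁ + εΔ, 1)` is at most
`(εΔ²)²`, hence at most `exp(n(εΔ²)²) - 1` for the sample (`sq_pi_gaussMix_real_sub_le`). Above the
boundary this tends to zero, so a test cannot separate the mixture from this element of the null,
and its second kind error is at least `1 - α - o(1)`.

Detection by the variance: Chebyshev's inequality puts both the null quantile and the statistic
within `O(√n)` of their centres on the scale of `(n-1)S²`, whereas the signal there is of order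
`nεΔ²` (`secondKindError_varTest_le`).

Detection by spacings: a single dyadic `k` with `n/8 < k ≤ n/4` suffices. The Gaussian tail is
strongly convex on compact subsets of `(0, ∞)`, so both tails of the mixture around its mean gain a
multiple of `εΔ²` (`gaussMix_real_tails_ge`). Order statistics are compared through counts and
Chebyshev's inequality. The multiplicity correction costs only a factor `log₂ n`, which a
polynomially small error absorbs.

The levels follow from translation invariance. For the spacing test one also needs the supremum
defining the corrected level to be attained, which uses the absence of atoms
(`measureReal_exists_quantile_lt_sSup_le`). -/

namespace MixtureDetection

/-! ### Sample laws as product measures. -/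

lemma gaussDensity_sub (μ x : ℝ) : gaussDensity (x - μ) = gaussianPDFReal μ 1 x := by
  simp [gaussDensity, gaussianPDFReal_sub]

lemma withDensity_gaussDensity (μ : ℝ) :
    (volume : Measure ℝ).withDensity (fun x => ENNReal.ofReal (gaussDensity (x - μ))) =
      gaussianReal μ 1 := by
  rw [gaussianReal_of_var_ne_zero μ one_ne_zero]
  congr 1
  funext x
  rw [gaussDensity_sub, gaussianPDF]

lemma sampleLaw_gaussDensity_sub (μ : ℝ) (n : ℕ) :
    sampleLaw (fun x => gaussDensity (x - μ)) n = Measure.pi fun _ : Fin n => gaussianReal μ 1 := by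
  rw [sampleLaw, withDensity_gaussDensity]

lemma sampleLaw_gaussDensity (n : ℕ) :
    sampleLaw gaussDensity n = Measure.pi fun _ : Fin n => gaussianReal 0 1 := by
  simpa using sampleLaw_gaussDensity_sub 0 n

/-- The Gaussian mixture with weights `1 - ε`, `ε` and means `μ₁`, `μ₂`, as a measure. -/
noncomputable def gaussMix (ε μ₁ μ₂ : ℝ) : Measure ℝ :=
  ENNReal.ofReal (1 - ε) • gaussianReal μ₁ 1 + ENNReal.ofReal ε • gaussianReal μ₂ 1

lemma isProbabilityMeasure_gaussMix {ε : ℝ} (hε : ε ∈ Set.Ioo (0 : ℝ) 1) (μ₁ μ₂ : ℝ) :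
    IsProbabilityMeasure (gaussMix ε μ₁ μ₂) := by
  refine ⟨?_⟩
  simp only [gaussMix, Measure.add_apply, Measure.smul_apply, measure_univ, smul_eq_mul, mul_one]
  rw [← ENNReal.ofReal_add (by linarith [hε.2]) hε.1.le]
  simp

lemma sampleLaw_mixture {ε : ℝ} (hε : ε ∈ Set.Ioo (0 : ℝ) 1) (μ₁ μ₂ : ℝ) (n : ℕ) :
    sampleLaw (mixture gaussDensity ε μ₁ μ₂) n =
      Measure.pi fun _ : Fin n => gaussMix ε μ₁ μ₂ := by
  have hm (μ : ℝ) : Measurable fun x => ENNReal.ofReal (gaussDensity (x - μ)) := by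
    simp only [gaussDensity_sub]
    exact (measurable_gaussianPDFReal μ 1).ennreal_ofReal
  rw [sampleLaw, gaussMix, ← withDensity_gaussDensity, ← withDensity_gaussDensity,
    ← withDensity_smul _ (hm μ₁), ← withDensity_smul _ (hm μ₂),
    ← withDensity_add_left ((hm μ₁).const_smul _)]
  congr
  funext _
  congr 1
  funext x
  have h (μ : ℝ) : 0 ≤ gaussDensity (x - μ) := gaussianPDFReal_nonneg 0 1 _
  have h1 : 0 ≤ 1 - ε := by linarith [hε.2]
  simp only [mixture, Pi.add_apply, Pi.smul_apply, smul_eq_mul]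
  rw [ENNReal.ofReal_add (mul_nonneg h1 (h _)) (mul_nonneg hε.1.le (h _)),
    ENNReal.ofReal_mul h1, ENNReal.ofReal_mul hε.1.le]

lemma integral_gaussMix {ε : ℝ} (hε : ε ∈ Set.Ioo (0 : ℝ) 1) {μ₁ μ₂ : ℝ} {g : ℝ → ℝ}
    (h1 : Integrable g (gaussianReal μ₁ 1)) (h2 : Integrable g (gaussianReal μ₂ 1)) :
    ∫ x, g x ∂gaussMix ε μ₁ μ₂ =
      (1 - ε) * ∫ x, g x ∂gaussianReal μ₁ 1 + ε * ∫ x, g x ∂gaussianReal μ₂ 1 := by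
  rw [gaussMix, integral_add_measure (h1.smul_measure ENNReal.ofReal_ne_top)
    (h2.smul_measure ENNReal.ofReal_ne_top), integral_smul_measure, integral_smul_measure,
    ENNReal.toReal_ofReal (by linarith [hε.2]), ENNReal.toReal_ofReal hε.1.le]
  rfl

lemma gaussMix_real_apply {ε : ℝ} (hε : ε ∈ Set.Ioo (0 : ℝ) 1) (μ₁ μ₂ : ℝ) (s : Set ℝ) :
    (gaussMix ε μ₁ μ₂).real s =
      (1 - ε) * (gaussianReal μ₁ 1).real s + ε * (gaussianReal μ₂ 1).real s := by
  rw [gaussMix, measureReal_add_apply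
      (ENNReal.mul_ne_top ENNReal.ofReal_ne_top (measure_ne_top _ _))
      (ENNReal.mul_ne_top ENNReal.ofReal_ne_top (measure_ne_top _ _)),
    measureReal_ennreal_smul_apply, measureReal_ennreal_smul_apply,
    ENNReal.toReal_ofReal (by linarith [hε.2]), ENNReal.toReal_ofReal hε.1.le]

lemma integrable_gaussMix {ε μ₁ μ₂ : ℝ} {g : ℝ → ℝ}
    (h1 : Integrable g (gaussianReal μ₁ 1)) (h2 : Integrable g (gaussianReal μ₂ 1)) :
    Integrable g (gaussMix ε μ₁ μ₂) :=
  (h1.smul_measure ENNReal.ofReal_ne_top).add_measure (h2.smul_measure ENNReal.ofReal_ne_top)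

lemma pi_gaussianReal_eq_map (μ : ℝ) (n : ℕ) :
    (Measure.pi fun _ : Fin n => gaussianReal μ 1) =
      (Measure.pi fun _ : Fin n => gaussianReal 0 1).map (fun x i => x i + μ) := by
  have h := gaussianReal_map_add_const (μ := 0) (v := 1) μ
  rw [Measure.pi_map_pi (X := fun _ => ℝ) (f := fun _ x => x + μ)]
  · simp [h]
  · intro i; fun_prop

/-! ### Quantiles and the corrected level. -/

section Quantile

variable {Ω : Type*} [MeasurableSpace Ω] {P : Measure Ω} [IsProbabilityMeasure P] {Y : Ω → ℝ}
  {p t : ℝ}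

lemma measureReal_le_eq_cdf (hY : Measurable Y) (t : ℝ) :
    P.real {x | Y x ≤ t} = cdf (P.map Y) t := by
  have := Measure.isProbabilityMeasure_map (μ := P) hY.aemeasurable
  rw [cdf_eq_real, map_measureReal_apply hY measurableSet_Iic]
  rfl

lemma bddBelow_quantile_set (hY : Measurable Y) (hp : 0 < p) :
    BddBelow {t : ℝ | p ≤ P.real {x | Y x ≤ t}} := by
  have := Measure.isProbabilityMeasure_map (μ := P) hY.aemeasurable
  obtain ⟨a, ha⟩ := ((tendsto_cdf_atBot (P.map Y)).eventually (gt_mem_nhds hp)).exists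
  refine ⟨a, fun t ht => ?_⟩
  by_contra! h
  simp only [Set.mem_ofPred_eq, measureReal_le_eq_cdf hY] at ht
  linarith [monotone_cdf (P.map Y) h.le]

lemma quantile_set_nonempty (hY : Measurable Y) (hp : p < 1) :
    {t : ℝ | p ≤ P.real {x | Y x ≤ t}}.Nonempty := by
  have := Measure.isProbabilityMeasure_map (μ := P) hY.aemeasurable
  obtain ⟨a, ha⟩ := ((tendsto_cdf_atTop (P.map Y)).eventually (lt_mem_nhds hp)).exists
  exact ⟨a, by simpa only [Set.mem_ofPred_eq, measureReal_le_eq_cdf hY] using ha.le⟩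

lemma quantile_le (hY : Measurable Y) (hp : 0 < p) (h : p ≤ P.real {x | Y x ≤ t}) :
    quantile P Y p ≤ t :=
  csInf_le (bddBelow_quantile_set hY hp) h

lemma measureReal_le_lt_of_lt_quantile (hY : Measurable Y) (hp : 0 < p) (h : t < quantile P Y p) :
    P.real {x | Y x ≤ t} < p := by
  by_contra! h'
  exact absurd (quantile_le hY hp h') (not_le.2 h)

/-- Right-continuity of the distribution function makes the infimum in the quantile a minimum. -/
lemma le_measureReal_le_quantile (hY : Measurable Y) (hp : p < 1) :
    p ≤ P.real {x | Y x ≤ quantile P Y p} := by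
  have := Measure.isProbabilityMeasure_map (μ := P) hY.aemeasurable
  rw [measureReal_le_eq_cdf hY]
  have hc : Tendsto (cdf (P.map Y)) (𝓝[>] (quantile P Y p))
      (𝓝 (cdf (P.map Y) (quantile P Y p))) :=
    ((cdf (P.map Y)).right_continuous _).mono Set.Ioi_subset_Ici_self
  refine ge_of_tendsto hc ?_
  filter_upwards [self_mem_nhdsWithin] with t ht
  obtain ⟨s, hs, hst⟩ := exists_lt_of_csInf_lt (quantile_set_nonempty (P := P) hY hp) ht
  simp only [Set.mem_ofPred_eq, measureReal_le_eq_cdf hY] at hs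
  exact hs.trans (monotone_cdf _ hst.le)

lemma quantile_mono (hY : Measurable Y) {p' : ℝ} (hp : 0 < p) (hp' : p' < 1) (h : p ≤ p') :
    quantile P Y p ≤ quantile P Y p' :=
  quantile_le hY hp (h.trans (le_measureReal_le_quantile hY hp'))

lemma measureReal_quantile_lt_le (hY : Measurable Y) {u : ℝ} (hu : 0 < u) :
    P.real {x | quantile P Y (1 - u) < Y x} ≤ u := by
  have h := le_measureReal_le_quantile (P := P) hY (p := 1 - u) (by linarith)
  have : {x | quantile P Y (1 - u) < Y x} = {x | Y x ≤ quantile P Y (1 - u)}ᶜ := by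
    ext x; simp
  rw [this, probReal_compl_eq_one_sub (measurableSet_le hY measurable_const)]
  linarith

/-- Without an atom at `t` the distribution function is also left-continuous there. -/
lemma measureReal_le_le_of_forall_lt (hna : P {x | Y x = t} = 0)
    (h : ∀ s < t, P.real {x | Y x ≤ s} ≤ p) : P.real {x | Y x ≤ t} ≤ p := by
  obtain ⟨s, hsm, hst, hs⟩ := exists_seq_strictMono_tendsto t
  have hU : {x | Y x ≤ t} =ᵐ[P] ⋃ m, {x | Y x ≤ s m} := by
    have : ∀ᵐ x ∂P, Y x ≠ t := by
      rw [ae_iff]; simpa using hna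
    filter_upwards [this] with x hx
    apply propext
    change Y x ≤ t ↔ x ∈ ⋃ m, {x | Y x ≤ s m}
    simp only [Set.mem_iUnion, Set.mem_ofPred_eq]
    constructor
    · intro hxt
      obtain ⟨m, hm⟩ := (hs.eventually (lt_mem_nhds (lt_of_le_of_ne hxt hx))).exists
      exact ⟨m, hm.le⟩
    · rintro ⟨m, hm⟩
      exact hm.trans (hst m).le
  rw [measureReal_congr hU]
  have hT := tendsto_measure_iUnion_atTop (μ := P) (s := fun m => {x | Y x ≤ s m})
    (fun a b hab x hx => le_trans hx (hsm.monotone hab))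
  have hT' := (ENNReal.tendsto_toReal (measure_ne_top P _)).comp hT
  exact le_of_tendsto' hT' fun m => h _ (hst m)

lemma le_measureReal_quantile_lt (hY : Measurable Y) (hna : ∀ c, P {x | Y x = c} = 0) {u : ℝ}
    (hu : u < 1) : u ≤ P.real {x | quantile P Y (1 - u) < Y x} := by
  have h := measureReal_le_le_of_forall_lt (hna (quantile P Y (1 - u))) (p := 1 - u)
    fun s hs => (measureReal_le_lt_of_lt_quantile hY (by linarith) hs).le
  have : {x | quantile P Y (1 - u) < Y x} = {x | Y x ≤ quantile P Y (1 - u)}ᶜ := by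
    ext x; simp
  rw [this, probReal_compl_eq_one_sub (measurableSet_le hY measurable_const)]
  linarith

/-- For statistics without atoms, the supremum defining the corrected level of a multiple
quantile test is attained. -/
lemma measureReal_exists_quantile_lt_sSup_le {ι : Type*} (K : Finset ι) (hK : K.Nonempty)
    (Z : ι → Ω → ℝ) (hZ : ∀ k ∈ K, Measurable (Z k)) (hna : ∀ k ∈ K, ∀ c, P {x | Z k x = c} = 0)
    {α : ℝ} (hα : α ∈ Set.Ioo (0 : ℝ) 1) {U : Set ℝ}
    (hU : U = {u : ℝ | u ∈ Set.Ioo (0 : ℝ) 1 ∧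
      P.real {x | ∃ k ∈ K, quantile P (Z k) (1 - u) < Z k x} ≤ α}) :
    α / K.card ≤ sSup U ∧ sSup U ≤ α ∧
      P.real {x | ∃ k ∈ K, quantile P (Z k) (1 - sSup U) < Z k x} ≤ α := by
  have hcard : (1 : ℝ) ≤ K.card := by exact_mod_cast hK.card_pos
  -- Bonferroni: this level is admissible by the union bound.
  have hmem : α / K.card ∈ U := by
    rw [hU]
    have h0 : 0 < α / K.card := div_pos hα.1 (by linarith)
    refine ⟨⟨h0, (div_le_self hα.1.le hcard).trans_lt hα.2⟩, ?_⟩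
    have : {x | ∃ k ∈ K, quantile P (Z k) (1 - α / K.card) < Z k x} =
        ⋃ k ∈ K, {x | quantile P (Z k) (1 - α / K.card) < Z k x} := by
      ext x; simp
    rw [this]
    calc _ ≤ ∑ k ∈ K, P.real {x | quantile P (Z k) (1 - α / K.card) < Z k x} :=
          measureReal_biUnion_finset_le _ _
      _ ≤ ∑ _k ∈ K, α / K.card :=
          Finset.sum_le_sum fun k hk => measureReal_quantile_lt_le (hZ k hk) h0
      _ = α := by
          rw [Finset.sum_const, nsmul_eq_mul]
          field_simp
  -- One index already has exceedance probability at least `u`, because its statistic has no atoms.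
  have hub : ∀ u ∈ U, u ≤ α := by
    intro u hu
    rw [hU] at hu
    obtain ⟨k, hk⟩ := hK
    refine (le_measureReal_quantile_lt (hZ k hk) (hna k hk) hu.1.2).trans
      (le_trans (measureReal_mono fun x hx => ?_) hu.2)
    exact ⟨k, hk, hx⟩
  have hbdd : BddAbove U := ⟨α, hub⟩
  have hle : sSup U ≤ α := csSup_le ⟨_, hmem⟩ hub
  refine ⟨le_csSup hbdd hmem, hle, ?_⟩
  set a := sSup U with ha
  obtain ⟨u, hum, hut, hu⟩ := exists_seq_tendsto_sSup ⟨_, hmem⟩ hbdd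
  have hu' := hu
  simp only [hU] at hu'
  have hua : ∀ m, u m ≤ a := fun m => le_csSup hbdd (hu m)
  have ha0 : 0 < a := (hu' 0).1.1.trans_le (hua 0)
  have hanti : ∀ k ∈ K, Antitone fun m => quantile P (Z k) (1 - u m) := by
    intro k hk m m' hmm
    exact quantile_mono (hZ k hk) (by linarith [(hu' m').1.2]) (by linarith [(hu' m).1.1])
      (by linarith [hum hmm])
  -- Quantile functions can jump, so the infimum `L` of the quantiles at `1 - u m` may exceed the
  -- one at `1 - a`. Both points nevertheless have distribution function `1 - a`, so the gap between
  -- them carries no mass, and the rejection regions increase to the limiting one up to a null set.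
  have hnull : ∀ k ∈ K, ∀ᵐ x ∂P, quantile P (Z k) (1 - a) < Z k x →
      ∃ m, quantile P (Z k) (1 - u m) < Z k x := by
    intro k hk
    have hlow : ∀ m, quantile P (Z k) (1 - a) ≤ quantile P (Z k) (1 - u m) := fun m =>
      quantile_mono (hZ k hk) (by linarith [hα.2]) (by linarith [(hu' m).1.1])
        (by linarith [hua m])
    set L := ⨅ m, quantile P (Z k) (1 - u m) with hL
    have hbL : BddBelow (Set.range fun m => quantile P (Z k) (1 - u m)) :=
      ⟨_, Set.forall_mem_range.2 hlow⟩
    have hqL : quantile P (Z k) (1 - a) ≤ L := le_ciInf hlow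
    have hFL : P.real {x | Z k x ≤ L} ≤ 1 - a := by
      refine measureReal_le_le_of_forall_lt (hna k hk L) fun s hs => ?_
      refine ge_of_tendsto' (tendsto_const_nhds.sub hut) fun m => ?_
      exact (measureReal_le_lt_of_lt_quantile (hZ k hk) (by linarith [(hu' m).1.2])
        (hs.trans_le (ciInf_le hbL m))).le
    have hFq := le_measureReal_le_quantile (P := P) (hZ k hk) (p := 1 - a) (by linarith)
    have hdiff : P ({x | Z k x ≤ L} \ {x | Z k x ≤ quantile P (Z k) (1 - a)}) = 0 := by
      have hsub : {x | Z k x ≤ quantile P (Z k) (1 - a)} ⊆ {x | Z k x ≤ L} :=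
        fun x hx => le_trans hx hqL
      have := measureReal_sdiff (μ := P) hsub ((hZ k hk) measurableSet_Iic)
      rw [← measureReal_eq_zero_iff]
      refine le_antisymm ?_ measureReal_nonneg
      linarith
    filter_upwards [measure_eq_zero_iff_ae_notMem.1 hdiff] with x hx hqx
    by_contra! hcon
    exact hx ⟨le_ciInf hcon, not_le.2 hqx⟩
  have hae : ∀ᵐ x ∂P, ∀ k ∈ K, quantile P (Z k) (1 - a) < Z k x →
      ∃ m, quantile P (Z k) (1 - u m) < Z k x :=
    (K.eventually_all).2 hnull
  have hT := tendsto_measure_iUnion_atTop (μ := P)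
    (s := fun m => {x | ∃ k ∈ K, quantile P (Z k) (1 - u m) < Z k x})
    (fun m m' hmm x ⟨k, hk, hx⟩ => ⟨k, hk, (hanti k hk hmm).trans_lt hx⟩)
  have hT' := (ENNReal.tendsto_toReal (measure_ne_top P _)).comp hT
  have hlim := le_of_tendsto' hT' fun m => (hu' m).2
  refine le_trans ?_ hlim
  refine ENNReal.toReal_mono (measure_ne_top P _) (measure_mono_ae ?_)
  filter_upwards [hae] with x hx hxa
  obtain ⟨k, hk, hxk⟩ := hxa
  obtain ⟨m, hm⟩ := hx k hk hxk
  exact Set.mem_iUnion.2 ⟨m, k, hk, hm⟩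

end Quantile

/-! ### Order statistics: counting, measurability, absence of atoms. -/

section OrderStat

variable {n : ℕ}

lemma orderStat_le_iff {x : Fin n → ℝ} {k : ℕ} (h1 : 1 ≤ k) (hk : k ≤ n) (t : ℝ) :
    orderStat x k ≤ t ↔ k ≤ (Finset.univ.filter fun i => x i ≤ t).card := by
  have h : 1 ≤ k ∧ k ≤ n := ⟨h1, hk⟩
  have hs := Tuple.lt_card_le_iff_apply_le_of_monotone (a := t) (j := ⟨k - 1, by omega⟩)
    (Tuple.monotone_sort x)
  have hc : (Finset.univ.filter fun i => (x ∘ Tuple.sort x) i ≤ t).card =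
      (Finset.univ.filter fun i => x i ≤ t).card :=
    Finset.card_equiv (Tuple.sort x) (by simp)
  rw [hc] at hs
  rw [orderStat, dif_pos h]
  rw [Function.comp_apply] at hs
  rw [← hs]
  simp only
  omega

lemma orderStat_add_const (x : Fin n → ℝ) (c : ℝ) {k : ℕ} (h1 : 1 ≤ k) (hk : k ≤ n) :
    orderStat (fun i => x i + c) k = orderStat x k + c := by
  refine eq_of_forall_ge_iff fun t => ?_
  rw [orderStat_le_iff h1 hk, ← le_sub_iff_add_le, orderStat_le_iff h1 hk]
  simp only [le_sub_iff_add_le]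

lemma measurable_orderStat {k : ℕ} (h1 : 1 ≤ k) (hk : k ≤ n) :
    Measurable fun x : Fin n → ℝ => orderStat x k := by
  refine measurable_of_Iic fun t => ?_
  have : (fun x : Fin n → ℝ => orderStat x k) ⁻¹' Set.Iic t =
      {x | k ≤ ∑ i : Fin n, if x i ≤ t then 1 else 0} := by
    ext x
    rw [Set.mem_preimage, Set.mem_Iic, orderStat_le_iff h1 hk, Finset.card_filter]
    rfl
  rw [this]
  refine measurableSet_le measurable_const (Finset.measurable_sum _ fun i _ => ?_)
  exact Measurable.ite (measurableSet_le (measurable_pi_apply i) measurable_const)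
    measurable_const measurable_const

lemma measurable_spacing {k : ℕ} (h1 : 1 ≤ k) (hk : 2 * k ≤ n) :
    Measurable (spacing k : (Fin n → ℝ) → ℝ) :=
  (measurable_orderStat (by omega) (by omega)).sub (measurable_orderStat h1 (by omega))

lemma spacing_add_const (x : Fin n → ℝ) (c : ℝ) {k : ℕ} (h1 : 1 ≤ k) (hk : 2 * k ≤ n) :
    spacing k (fun i => x i + c) = spacing k x := by
  rw [spacing, spacing, orderStat_add_const x c (by omega) (by omega),
    orderStat_add_const x c h1 (by omega)]
  ring

/-- The difference of two independent standard Gaussians is `N(0, 2)`. -/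
lemma measure_sub_eq_const (c : ℝ) {i j : Fin n} (hij : i ≠ j) :
    (Measure.pi fun _ : Fin n => gaussianReal 0 1) {x | x i - x j = c} = 0 := by
  set P := Measure.pi fun _ : Fin n => gaussianReal 0 1
  have hm (i : Fin n) : P.map (fun x => x i) = gaussianReal 0 1 :=
    (measurePreserving_eval (fun _ : Fin n => gaussianReal 0 1) i).map_eq
  have hind : IndepFun (fun x : Fin n → ℝ => x i) (fun x => -x j) P :=
    ((iIndepFun_pi (μ := fun _ : Fin n => gaussianReal 0 1) (X := fun _ x => x)
      (fun _ => aemeasurable_id)).indepFun hij).comp measurable_id measurable_neg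
  have hneg : P.map (fun x => -x j) = gaussianReal 0 1 := by
    have h := Measure.map_map (μ := P) (g := fun y : ℝ => -y) (f := fun x : Fin n → ℝ => x j)
      (by fun_prop) (by fun_prop)
    rw [hm, gaussianReal_map_neg, neg_zero] at h
    exact h.symm
  have hadd := gaussianReal_add_gaussianReal_of_indepFun hind (hm i) hneg
  have hna : gaussianReal (0 + 0) (1 + 1) {c} = 0 :=
    (nullSingletonClass_gaussianReal (by norm_num)).measure_singleton c
  rw [← hadd, Measure.map_apply (by fun_prop) (measurableSet_singleton c)] at hna
  convert hna using 2
  ext x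
  simp [sub_eq_add_neg]

/-- A spacing is always a difference of two coordinates; `2 * k ≤ n` makes the two ranks, hence the
indices, distinct. A finite union over pairs then suffices. -/
lemma measure_spacing_eq_const (c : ℝ) {k : ℕ} (h1 : 1 ≤ k) (hk : 2 * k ≤ n) :
    (Measure.pi fun _ : Fin n => gaussianReal 0 1) {x | spacing k x = c} = 0 := by
  refine measure_mono_null (t := ⋃ i, ⋃ j, ⋃ (_ : i ≠ j), {x : Fin n → ℝ | x i - x j = c}) ?_ ?_
  · intro x hx
    simp only [Set.mem_iUnion]
    have hx : spacing k x = c := hx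
    rw [spacing, orderStat, orderStat, dif_pos (by omega), dif_pos (by omega)] at hx
    refine ⟨_, _, ?_, hx⟩
    rw [(Tuple.sort x).injective.ne_iff, ne_eq, Fin.mk.injEq]
    omega
  · simp only [measure_iUnion_null_iff]
    exact fun i j hij => measure_sub_eq_const c hij

end OrderStat

/-! ### The dyadic index set. -/

section Dyadic

variable {n : ℕ}

lemma le_floor_logb_half_iff (hn : 2 ≤ n) (j : ℕ) :
    j ≤ ⌊Real.logb 2 ((n : ℝ) / 2)⌋₊ ↔ 2 * 2 ^ j ≤ n := by
  have hn' : (2 : ℝ) ≤ n := by exact_mod_cast hn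
  rw [Nat.le_floor_iff (Real.logb_nonneg (by norm_num) (by linarith)),
    Real.le_logb_iff_rpow_le (by norm_num) (by linarith), Real.rpow_natCast,
    le_div_iff₀ (by norm_num), mul_comm]
  exact_mod_cast Iff.rfl

lemma two_pow_mem_dyadicSet (hn : 2 ≤ n) {j : ℕ} (hj : 2 * 2 ^ j ≤ n) : 2 ^ j ∈ dyadicSet n :=
  Finset.mem_image_of_mem _ (Finset.mem_range_succ_iff.2 ((le_floor_logb_half_iff hn j).2 hj))

lemma bounds_of_mem_dyadicSet (hn : 2 ≤ n) {k : ℕ} (hk : k ∈ dyadicSet n) :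
    1 ≤ k ∧ 2 * k ≤ n := by
  obtain ⟨j, hj, rfl⟩ := Finset.mem_image.1 hk
  exact ⟨Nat.one_le_two_pow, (le_floor_logb_half_iff hn j).1 (Finset.mem_range_succ_iff.1 hj)⟩

lemma dyadicSet_nonempty (n : ℕ) : (dyadicSet n).Nonempty :=
  ⟨2 ^ 0, Finset.mem_image_of_mem _ (by simp)⟩

lemma card_dyadicSet_le (hn : 2 ≤ n) : ((dyadicSet n).card : ℝ) ≤ Real.logb 2 n := by
  have hn' : (2 : ℝ) ≤ n := by exact_mod_cast hn
  have h1 : ((dyadicSet n).card : ℝ) ≤ (⌊Real.logb 2 ((n : ℝ) / 2)⌋₊ : ℝ) + 1 := by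
    have := (Finset.card_image_le : (dyadicSet n).card ≤ _)
    rw [Finset.card_range] at this
    exact_mod_cast this
  have h2 := Nat.floor_le (Real.logb_nonneg (b := 2) (x := (n : ℝ) / 2) (by norm_num)
    (by linarith))
  rw [Real.logb_div (by linarith) (by norm_num), Real.logb_self_eq_one (by norm_num)] at h2 h1
  linarith

end Dyadic

/-! ### Levels of the two tests. -/

/-- Every null law is the image of the centred one under a common shift, which preserves the
rejection region, so one null computation controls all of them. -/
lemma isLevelTest_of_translation_invariant {n : ℕ} {α : ℝ} {A : Set (Fin n → ℝ)}
    [DecidablePred (· ∈ A)]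
    (hA : MeasurableSet A) (hinv : ∀ x (c : ℝ), (fun i => x i + c) ∈ A ↔ x ∈ A)
    (hle : (Measure.pi fun _ : Fin n => gaussianReal 0 1).real A ≤ α) :
    IsLevelTest gaussDensity n α (fun x => if x ∈ A then 1 else 0) := by
  refine ⟨Measurable.ite hA measurable_const measurable_const, ?_⟩
  rintro f ⟨μ, rfl⟩
  have : {x : Fin n → ℝ | (if x ∈ A then (1 : Fin 2) else 0) = 1} = A := by
    ext x
    simp
  rw [this, sampleLaw_gaussDensity_sub, pi_gaussianReal_eq_map,
    map_measureReal_apply (by fun_prop) hA]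
  refine le_of_eq_of_le ?_ hle
  congr 1
  ext x
  exact hinv x μ

lemma correctedLevel_bounds {n : ℕ} (hn : 2 ≤ n) {α : ℝ} (hα : α ∈ Set.Ioo (0 : ℝ) 1) :
    α / (dyadicSet n).card ≤ correctedLevel gaussDensity n α ∧
      correctedLevel gaussDensity n α ≤ α ∧
      (sampleLaw gaussDensity n).real {x | ∃ k ∈ dyadicSet n,
        spacingQuantile gaussDensity n (correctedLevel gaussDensity n α) k < spacing k x} ≤ α := by
  have : IsProbabilityMeasure (sampleLaw gaussDensity n) := by
    rw [sampleLaw_gaussDensity]; infer_instance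
  refine measureReal_exists_quantile_lt_sSup_le (P := sampleLaw gaussDensity n) (dyadicSet n)
    (dyadicSet_nonempty n) spacing ?_ ?_ hα rfl
  · intro k hk
    obtain ⟨h1, h2⟩ := bounds_of_mem_dyadicSet hn hk
    exact measurable_spacing h1 h2
  · intro k hk c
    obtain ⟨h1, h2⟩ := bounds_of_mem_dyadicSet hn hk
    rw [sampleLaw_gaussDensity]
    exact measure_spacing_eq_const c h1 h2

open Classical in
lemma orderTest_eq_ite (n : ℕ) (α : ℝ) :
    orderTest gaussDensity n α = fun x => if x ∈ {x | ∃ k ∈ dyadicSet n,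
      spacingQuantile gaussDensity n (correctedLevel gaussDensity n α) k < spacing k x}
      then 1 else 0 := by
  funext x
  rw [orderTest]
  split_ifs with h
  · obtain ⟨k, hk, hx⟩ := h
    refine le_antisymm (Fin.le_last _) ?_
    have := Finset.le_sup (f := fun k => if spacingQuantile gaussDensity n
      (correctedLevel gaussDensity n α) k < spacing k x then (1 : Fin 2) else 0) hk
    rwa [if_pos hx] at this
  · refine le_antisymm (Finset.sup_le fun k hk => ?_) (Fin.zero_le _)
    rw [if_neg fun hx => h ⟨k, hk, hx⟩]

lemma isLevelTest_orderTest {n : ℕ} (hn : 2 ≤ n) {α : ℝ} (hα : α ∈ Set.Ioo (0 : ℝ) 1) :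
    IsLevelTest gaussDensity n α (orderTest gaussDensity n α) := by
  classical
  rw [orderTest_eq_ite]
  refine isLevelTest_of_translation_invariant ?_ ?_ ?_
  · have : {x : Fin n → ℝ | ∃ k ∈ dyadicSet n,
        spacingQuantile gaussDensity n (correctedLevel gaussDensity n α) k < spacing k x} =
        ⋃ k ∈ dyadicSet n, {x | spacingQuantile gaussDensity n
          (correctedLevel gaussDensity n α) k < spacing k x} := by
      ext x; simp
    rw [this]
    refine Finset.measurableSet_biUnion _ fun k hk => ?_
    obtain ⟨h1, h2⟩ := bounds_of_mem_dyadicSet hn hk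
    exact measurableSet_lt measurable_const (measurable_spacing h1 h2)
  · intro x c
    refine exists_congr fun k => and_congr_right fun hk => ?_
    obtain ⟨h1, h2⟩ := bounds_of_mem_dyadicSet hn hk
    rw [spacing_add_const x c h1 h2]
  · rw [← sampleLaw_gaussDensity]
    exact (correctedLevel_bounds hn hα).2.2

lemma measurable_empVar (n : ℕ) : Measurable (empVar : (Fin n → ℝ) → ℝ) := by
  unfold empVar empMean
  fun_prop

lemma empVar_add_const {n : ℕ} (x : Fin n → ℝ) (c : ℝ) :
    empVar (fun i => x i + c) = empVar x := by
  rcases Nat.eq_zero_or_pos n with rfl | hn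
  · simp [empVar]
  have hn' : (n : ℝ) ≠ 0 := by positivity
  have : empMean (fun i => x i + c) = empMean x + c := by
    simp only [empMean, Finset.sum_add_distrib, Finset.sum_const, Finset.card_univ,
      Fintype.card_fin, nsmul_eq_mul]
    field_simp
  simp only [empVar, this, add_sub_add_right_eq_sub]

lemma isLevelTest_varTest (n : ℕ) {α : ℝ} (hα : 0 < α) :
    IsLevelTest gaussDensity n α (varTest gaussDensity n α) := by
  classical
  refine isLevelTest_of_translation_invariant
    (A := {x | quantile (sampleLaw gaussDensity n) empVar (1 - α) < empVar x}) ?_ ?_ ?_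
  · exact measurableSet_lt measurable_const (measurable_empVar n)
  · intro x c
    simp only [Set.mem_ofPred_eq]
    rw [empVar_add_const]
  · rw [← sampleLaw_gaussDensity]
    have : IsProbabilityMeasure (sampleLaw gaussDensity n) := by
      rw [sampleLaw_gaussDensity]; infer_instance
    exact measureReal_quantile_lt_le (measurable_empVar n) hα

/-! ### The `χ²` bound for product laws. -/

section ChiSquare

variable {E : Type*} [MeasurableSpace E] {ν : Measure E} [IsProbabilityMeasure ν] {l : E → ℝ}

lemma pi_withDensity_ofReal (hl0 : ∀ x, 0 ≤ l x) (hli : Integrable l ν) (n : ℕ) :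
    (Measure.pi fun _ : Fin n => ν.withDensity fun x => ENNReal.ofReal (l x)) =
      (Measure.pi fun _ : Fin n => ν).withDensity fun x => ENNReal.ofReal (∏ i, l (x i)) := by
  have : IsFiniteMeasure (ν.withDensity fun x => ENNReal.ofReal (l x)) :=
    isFiniteMeasure_withDensity_ofReal hli.2
  refine Measure.pi_eq fun s hs => ?_
  rw [withDensity_apply _ (MeasurableSet.univ_pi hs), Measure.restrict_pi_pi,
    ← ofReal_integral_eq_lintegral_ofReal, integral_fintype_prod_eq_prod (fun _ => l),
    ENNReal.ofReal_prod_of_nonneg fun i _ => integral_nonneg hl0]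
  · refine Finset.prod_congr rfl fun i _ => ?_
    rw [withDensity_apply _ (hs i), ofReal_integral_eq_lintegral_ofReal hli.restrict
      (Eventually.of_forall hl0)]
  · exact Integrable.fintype_prod fun i => hli.restrict
  · exact Eventually.of_forall fun x => Finset.prod_nonneg fun i _ => hl0 _

/-- The `χ²` bound for the difference of two product laws on an event. -/
lemma sq_pi_real_sub_le (hl0 : ∀ x, 0 ≤ l x) (hlm : Measurable l) (hli : Integrable l ν)
    (hl1 : ∫ x, l x ∂ν = 1) (hl2 : Integrable (fun x => l x ^ 2) ν) (n : ℕ)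
    {A : Set (Fin n → E)} (hA : MeasurableSet A) :
    ((Measure.pi fun _ : Fin n => ν.withDensity fun x => ENNReal.ofReal (l x)).real A -
      (Measure.pi fun _ : Fin n => ν).real A) ^ 2 ≤ (∫ x, l x ^ 2 ∂ν) ^ n - 1 := by
  rw [pi_withDensity_ofReal hl0 hli]
  set P := Measure.pi fun _ : Fin n => ν
  set L : (Fin n → E) → ℝ := fun x => ∏ i, l (x i) with hL
  have hL0 : ∀ x, 0 ≤ L x := fun x => Finset.prod_nonneg fun i _ => hl0 _
  have hLm : Measurable L := by fun_prop
  have hLi : Integrable L P := Integrable.fintype_prod fun _ => hli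
  have hL1 : ∫ x, L x ∂P = 1 := by
    rw [hL, integral_fintype_prod_eq_prod (fun _ => l)]
    simp [hl1]
  have hLsq : ∀ x, L x ^ 2 = ∏ i, l (x i) ^ 2 := fun x => (Finset.prod_pow _ _ _).symm
  have hL2i : Integrable (fun x => L x ^ 2) P := by
    simp only [hLsq]
    exact Integrable.fintype_prod fun _ => hl2
  have hL2 : ∫ x, L x ^ 2 ∂P = (∫ x, l x ^ 2 ∂ν) ^ n := by
    simp only [hLsq]
    rw [integral_fintype_prod_eq_prod (fun _ x => l x ^ 2)]
    simp
  have hreal : (P.withDensity fun x => ENNReal.ofReal (L x)).real A = ∫ x in A, L x ∂P := by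
    rw [measureReal_def, withDensity_apply _ hA, integral_eq_lintegral_of_nonneg_ae
      (Eventually.of_forall hL0) hLm.aestronglyMeasurable]
  have hD : MemLp (A.indicator fun x => L x - 1) 2 P := by
    refine MemLp.indicator hA ?_
    exact ((memLp_two_iff_integrable_sq hLm.aestronglyMeasurable).2 hL2i).sub (memLp_const 1)
  have hdiff : (P.withDensity fun x => ENNReal.ofReal (L x)).real A - P.real A =
      ∫ x, A.indicator (fun x => L x - 1) x ∂P := by
    rw [hreal, integral_indicator hA, integral_sub hLi.restrict (integrable_const _)]
    simp
  rw [hdiff]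
  -- Nonnegativity of the variance serves as Cauchy–Schwarz: the squared mean of `1_A (L - 1)` is at
  -- most its second moment, hence at most that of `L - 1`.
  have hvar := variance_nonneg (A.indicator fun x => L x - 1) P
  rw [variance_eq_sub hD] at hvar
  have hexp : (∫ x, (L x - 1) ^ 2 ∂P) = (∫ x, l x ^ 2 ∂ν) ^ n - 1 := by
    have : ∀ x, (L x - 1) ^ 2 = L x ^ 2 - 2 * L x + 1 := fun x => by ring
    simp only [this]
    have hi : Integrable (fun x => L x ^ 2 - 2 * L x) P := hL2i.sub (hLi.const_mul 2)
    rw [integral_add hi (integrable_const _),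
      integral_sub hL2i (hLi.const_mul 2), integral_const_mul, hL1, hL2]
    simp
    ring
  rw [← hexp]
  refine (sub_nonneg.1 hvar).trans ?_
  refine integral_mono hD.integrable_sq ?_ fun x => ?_
  · exact (((memLp_two_iff_integrable_sq hLm.aestronglyMeasurable).2 hL2i).sub
      (memLp_const 1)).integrable_sq
  · by_cases hx : x ∈ A
    · simp [hx]
    · simp [hx, sq_nonneg]

end ChiSquare

/-! ### Impossibility: the mixture against the Gaussian with the same mean. -/

/-- The density of `N(μ, 1)` with respect to `N(m, 1)`. -/
noncomputable def gaussRatio (m μ x : ℝ) : ℝ :=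
  Real.exp ((μ - m) * (x - m) - (μ - m) ^ 2 / 2)

lemma measurable_gaussRatio (m μ : ℝ) : Measurable (gaussRatio m μ) := by
  unfold gaussRatio
  fun_prop

lemma gaussianReal_eq_withDensity_gaussRatio (m μ : ℝ) :
    gaussianReal μ 1 =
      (gaussianReal m 1).withDensity fun x => ENNReal.ofReal (gaussRatio m μ x) := by
  rw [gaussianReal_of_var_ne_zero μ one_ne_zero, gaussianReal_of_var_ne_zero m one_ne_zero,
    ← withDensity_mul _ (measurable_gaussianPDF m 1) (measurable_gaussRatio m μ).ennreal_ofReal]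
  congr 1
  funext x
  rw [Pi.mul_apply, gaussianPDF, gaussianPDF, ← ENNReal.ofReal_mul (gaussianPDFReal_nonneg _ _ _)]
  congr 1
  rw [gaussianPDFReal, gaussianPDFReal, gaussRatio, mul_assoc _ (Real.exp _), ← Real.exp_add]
  congr 2
  simp
  ring

lemma gaussRatio_mul (m μ μ' x : ℝ) : gaussRatio m μ x * gaussRatio m μ' x =
    Real.exp (-(μ + μ' - 2 * m) * m - (μ - m) ^ 2 / 2 - (μ' - m) ^ 2 / 2) *
      Real.exp ((μ + μ' - 2 * m) * x) := by
  rw [gaussRatio, gaussRatio, ← Real.exp_add, ← Real.exp_add]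
  ring_nf

lemma integrable_gaussRatio_mul (m μ μ' : ℝ) :
    Integrable (fun x => gaussRatio m μ x * gaussRatio m μ' x) (gaussianReal m 1) := by
  simp only [gaussRatio_mul]
  exact (integrable_exp_mul_gaussianReal _).const_mul _

/-- The product of two likelihood ratios is an exponential of a linear function, so this is the
Gaussian moment generating function. -/
lemma integral_gaussRatio_mul (m μ μ' : ℝ) :
    ∫ x, gaussRatio m μ x * gaussRatio m μ' x ∂gaussianReal m 1 =
      Real.exp ((μ - m) * (μ' - m)) := by
  have h : ∀ t, ∫ x, Real.exp (t * x) ∂gaussianReal m 1 = Real.exp (m * t + t ^ 2 / 2) := fun t => by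
    have := congrFun (mgf_fun_id_gaussianReal (μ := m) (v := 1)) t
    simpa [mgf] using this
  simp only [gaussRatio_mul]
  rw [integral_const_mul, h, ← Real.exp_add]
  ring_nf

lemma gaussRatio_self (m x : ℝ) : gaussRatio m m x = 1 := by simp [gaussRatio]

lemma integrable_gaussRatio (m μ : ℝ) : Integrable (gaussRatio m μ) (gaussianReal m 1) := by
  simpa [gaussRatio_self] using integrable_gaussRatio_mul m μ m

lemma integral_gaussRatio (m μ : ℝ) : ∫ x, gaussRatio m μ x ∂gaussianReal m 1 = 1 := by
  simpa [gaussRatio_self] using integral_gaussRatio_mul m μ m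

/-- Relative to the mixture mean `m`, the components sit at `u₁ = -εΔ` and `u₂ = (1-ε)Δ` with
weights `w₁ = 1-ε`, `w₂ = ε`, and the second moment of the likelihood ratio is `∑ wᵢ wⱼ exp(uᵢ uⱼ)`.
The linear term of the exponential contributes `(∑ wᵢ uᵢ)² = 0`, the quadratic bound `(∑ wᵢ uᵢ²)² =
(ε(1-ε)Δ²)²`. -/
lemma sq_pi_gaussMix_real_sub_le {ε Δ : ℝ} (hε : ε ∈ Set.Ioo (0 : ℝ) 1) (hΔ : 0 ≤ Δ) (hΔ1 : Δ ≤ 1)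
    (μ : ℝ) (n : ℕ) {A : Set (Fin n → ℝ)} (hA : MeasurableSet A) :
    ((Measure.pi fun _ : Fin n => gaussMix ε μ (μ + Δ)).real A -
      (Measure.pi fun _ : Fin n => gaussianReal (μ + ε * Δ) 1).real A) ^ 2 ≤
      Real.exp (n * (ε * Δ ^ 2) ^ 2) - 1 := by
  obtain ⟨h0, h1⟩ := hε
  set m := μ + ε * Δ with hm
  set l : ℝ → ℝ := fun x => (1 - ε) * gaussRatio m μ x + ε * gaussRatio m (μ + Δ) x with hl
  have h1ε : 0 ≤ 1 - ε := by linarith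
  have hpos : ∀ μ x, 0 ≤ gaussRatio m μ x := fun μ x => (Real.exp_pos _).le
  have hmix : gaussMix ε μ (μ + Δ) =
      (gaussianReal m 1).withDensity fun x => ENNReal.ofReal (l x) := by
    have hmeas := fun μ => (measurable_gaussRatio m μ).ennreal_ofReal
    rw [gaussMix, gaussianReal_eq_withDensity_gaussRatio m μ,
      gaussianReal_eq_withDensity_gaussRatio m (μ + Δ), ← withDensity_smul _ (hmeas _),
      ← withDensity_smul _ (hmeas _), ← withDensity_add_left ((hmeas _).const_smul _)]
    congr 1
    funext x
    simp only [Pi.add_apply, Pi.smul_apply, smul_eq_mul, hl]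
    rw [ENNReal.ofReal_add (mul_nonneg h1ε (hpos _ _)) (mul_nonneg h0.le (hpos _ _)),
      ENNReal.ofReal_mul h1ε, ENNReal.ofReal_mul h0.le]
  have hi1 := integrable_gaussRatio m μ
  have hi2 := integrable_gaussRatio m (μ + Δ)
  have hsq : ∀ x, l x ^ 2 = (1 - ε) ^ 2 * (gaussRatio m μ x * gaussRatio m μ x) +
      2 * ε * (1 - ε) * (gaussRatio m μ x * gaussRatio m (μ + Δ) x) +
      ε ^ 2 * (gaussRatio m (μ + Δ) x * gaussRatio m (μ + Δ) x) := fun x => by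
    simp only [hl]; ring
  have j1 := (integrable_gaussRatio_mul m μ μ).const_mul ((1 - ε) ^ 2)
  have j2 := (integrable_gaussRatio_mul m μ (μ + Δ)).const_mul (2 * ε * (1 - ε))
  have j3 := (integrable_gaussRatio_mul m (μ + Δ) (μ + Δ)).const_mul (ε ^ 2)
  have hmain := sq_pi_real_sub_le (ν := gaussianReal m 1) (l := l)
    (fun x => add_nonneg (mul_nonneg h1ε (hpos _ _)) (mul_nonneg h0.le (hpos _ _)))
    (((measurable_gaussRatio m μ).const_mul _).add ((measurable_gaussRatio m _).const_mul _))
    ((hi1.const_mul _).add (hi2.const_mul _))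
    (by
      rw [hl, integral_add (hi1.const_mul _) (hi2.const_mul _), integral_const_mul,
        integral_const_mul, integral_gaussRatio, integral_gaussRatio]
      ring)
    (by simp only [hsq]; exact (j1.add j2).add j3) n hA
  rw [hmix]
  refine hmain.trans ?_
  have hchi : ∫ x, l x ^ 2 ∂gaussianReal m 1 ≤ 1 + (ε * Δ ^ 2) ^ 2 := by
    simp only [hsq]
    have j12 : Integrable (fun x => (1 - ε) ^ 2 * (gaussRatio m μ x * gaussRatio m μ x) +
      2 * ε * (1 - ε) * (gaussRatio m μ x * gaussRatio m (μ + Δ) x)) (gaussianReal m 1) := j1.add j2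
    rw [integral_add j12 j3, integral_add j1 j2, integral_const_mul, integral_const_mul,
      integral_const_mul, integral_gaussRatio_mul, integral_gaussRatio_mul,
      integral_gaussRatio_mul]
    -- This is where `Δ ≤ 1` enters: it keeps the three exponents in `[-1, 1]`.
    have hexp : ∀ y : ℝ, |y| ≤ 1 → Real.exp y ≤ 1 + y + y ^ 2 := fun y hy => by
      linarith [(abs_le.1 (Real.abs_exp_sub_one_sub_id_le hy)).2]
    have e1 : μ - m = -(ε * Δ) := by rw [hm]; ring
    have e2 : μ + Δ - m = (1 - ε) * Δ := by rw [hm]; ring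
    rw [e1, e2]
    have ha : ε * Δ ≤ 1 := mul_le_one₀ h1.le hΔ hΔ1
    have hb : (1 - ε) * Δ ≤ 1 := mul_le_one₀ (by linarith) hΔ hΔ1
    have ha0 : 0 ≤ ε * Δ := by positivity
    have hb0 : 0 ≤ (1 - ε) * Δ := mul_nonneg h1ε hΔ
    have x1 := hexp (-(ε * Δ) * -(ε * Δ)) (abs_le.2 ⟨by nlinarith, by nlinarith⟩)
    have x2 := hexp (-(ε * Δ) * ((1 - ε) * Δ)) (abs_le.2 ⟨by nlinarith, by nlinarith⟩)
    have x3 := hexp ((1 - ε) * Δ * ((1 - ε) * Δ)) (abs_le.2 ⟨by nlinarith, by nlinarith⟩)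
    have y1 := mul_le_mul_of_nonneg_left x1 (sq_nonneg (1 - ε))
    have y2 := mul_le_mul_of_nonneg_left x2 (by positivity : 0 ≤ 2 * ε * (1 - ε))
    have y3 := mul_le_mul_of_nonneg_left x3 (sq_nonneg ε)
    have hfin : (ε * (1 - ε) * Δ ^ 2) ^ 2 ≤ (ε * Δ ^ 2) ^ 2 := by
      refine pow_le_pow_left₀ (by positivity) ?_ 2
      have : 0 ≤ ε * ε * Δ ^ 2 := by positivity
      nlinarith
    refine (add_le_add (add_le_add y1 y2) y3).trans ?_
    refine le_trans (le_of_eq ?_) (add_le_add_right hfin 1)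
    ring
  have h2 : 0 ≤ ∫ x, l x ^ 2 ∂gaussianReal m 1 := integral_nonneg fun x => sq_nonneg _
  have := pow_le_pow_left₀ h2 (hchi.trans
    ((add_comm _ _).trans_le (Real.add_one_le_exp _))) n
  rw [← Real.exp_nat_mul] at this
  linarith

lemma measureReal_zero_eq {n : ℕ} {P : Measure (Fin n → ℝ)} [IsProbabilityMeasure P]
    {T : (Fin n → ℝ) → Fin 2} (hT : Measurable T) :
    P.real {x | T x = 0} = 1 - P.real {x | T x = 1} := by
  have : {x | T x = 0} = {x | T x = 1}ᶜ := by
    ext x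
    simp only [Set.mem_ofPred_eq, Set.mem_compl_iff]
    have := T x
    omega
  rw [this, probReal_compl_eq_one_sub (measurableSet_eq_fun hT measurable_const)]

/-- The comparison law `N(μ + εΔ, 1)` belongs to the null, so acceptance there has probability at
least `1 - α`; passing to the mixture loses at most the square root of the `χ²` bound. -/
lemma le_secondKindError {α ε Δ μ : ℝ} (hε : ε ∈ Set.Ioo (0 : ℝ) 1) (hΔ : 0 ≤ Δ) (hΔ1 : Δ ≤ 1)
    {n : ℕ} {T : (Fin n → ℝ) → Fin 2} (hT : IsLevelTest gaussDensity n α T) :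
    1 - α - √(Real.exp (n * (ε * Δ ^ 2) ^ 2) - 1) ≤
      secondKindError (mixture gaussDensity ε μ (μ + Δ)) T := by
  have hA : MeasurableSet {x | T x = 0} := hT.measurable (measurableSet_singleton 0)
  have h := Real.abs_le_sqrt (sq_pi_gaussMix_real_sub_le hε hΔ hΔ1 μ n hA)
  have hl := hT.level _ ⟨μ + ε * Δ, rfl⟩
  rw [sampleLaw_gaussDensity_sub] at hl
  rw [measureReal_zero_eq (P := Measure.pi fun _ : Fin n => gaussianReal (μ + ε * Δ) 1)
    hT.measurable] at h
  rw [secondKindError, sampleLaw_mixture hε]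
  linarith [(abs_le.1 h).1]

/-! ### Asymptotics above the boundary. -/

namespace DenseRegime

variable {δ r : ℝ} {ε μ₁ μ₂ : ℕ → ℝ}

lemma tendsto_of_tendsto_div_rpow {a : ℕ → ℝ} {s : ℝ} (hs : 0 < s)
    (h : Tendsto (fun n : ℕ => a n / (n : ℝ) ^ (-s)) atTop (𝓝 1)) : Tendsto a atTop (𝓝 0) := by
  have h0 := (tendsto_rpow_neg_atTop hs).comp tendsto_natCast_atTop_atTop
  have := h.mul h0
  rw [mul_zero] at this
  refine this.congr' ?_
  filter_upwards [eventually_gt_atTop 0] with n hn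
  have : (0 : ℝ) < (n : ℝ) ^ (-s) := Real.rpow_pos_of_pos (by exact_mod_cast hn) _
  simp only [Function.comp]
  field_simp

lemma tendsto_eps (h : DenseRegime δ r ε μ₁ μ₂) (hδ : 0 < δ) : Tendsto ε atTop (𝓝 0) :=
  tendsto_of_tendsto_div_rpow hδ h.eps_equiv

lemma tendsto_gap (h : DenseRegime δ r ε μ₁ μ₂) (hr : 0 < r) :
    Tendsto (fun n => μ₂ n - μ₁ n) atTop (𝓝 0) :=
  tendsto_of_tendsto_div_rpow hr h.gap_equiv

lemma tendsto_signal (h : DenseRegime δ r ε μ₁ μ₂) :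
    Tendsto (fun n : ℕ => ε n * (μ₂ n - μ₁ n) ^ 2 / (n : ℝ) ^ (-(δ + 2 * r))) atTop (𝓝 1) := by
  have := h.eps_equiv.mul (h.gap_equiv.pow 2)
  rw [one_pow, mul_one] at this
  refine this.congr' ?_
  filter_upwards [eventually_gt_atTop 0] with n hn
  have hn' : (0 : ℝ) < n := by exact_mod_cast hn
  rw [div_pow, div_mul_div_comm, ← Real.rpow_natCast ((n : ℝ) ^ (-r)) 2, ← Real.rpow_mul hn'.le,
    ← Real.rpow_add hn']
  congr 2
  push_cast
  ring

/-- The quantity has order `n^{1 - 2(δ + 2r)}`, and `hb` says exactly that this exponent is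
negative. -/
lemma tendsto_sq_signal (h : DenseRegime δ r ε μ₁ μ₂) (hb : 1 / 4 - δ / 2 < r) :
    Tendsto (fun n : ℕ => n * (ε n * (μ₂ n - μ₁ n) ^ 2) ^ 2) atTop (𝓝 0) := by
  have h0 := (tendsto_rpow_neg_atTop (y := 2 * (δ + 2 * r) - 1) (by linarith)).comp
    tendsto_natCast_atTop_atTop
  have := (h.tendsto_signal.pow 2).mul h0
  rw [mul_zero] at this
  refine this.congr' ?_
  filter_upwards [eventually_gt_atTop 0] with n hn
  have hn' : (0 : ℝ) < n := by exact_mod_cast hn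
  have e : (n : ℝ) ^ (-(2 * (δ + 2 * r) - 1)) = n * ((n : ℝ) ^ (-(δ + 2 * r))) ^ 2 := by
    rw [← Real.rpow_natCast _ 2, ← Real.rpow_mul hn'.le]
    nth_rewrite 2 [← Real.rpow_one (n : ℝ)]
    rw [← Real.rpow_add hn']
    congr 1
    push_cast
    ring
  have hp : (0 : ℝ) < (n : ℝ) ^ (-(δ + 2 * r)) := Real.rpow_pos_of_pos hn' _
  simp only [Function.comp]
  rw [e]
  field_simp

lemma eventually_lt_secondKindError (h : DenseRegime δ r ε μ₁ μ₂) (hr : 0 < r)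
    (hb : 1 / 4 - δ / 2 < r) {α β : ℝ} (hβ : β < 1 - α) :
    ∀ᶠ n : ℕ in atTop, ∀ T : (Fin n → ℝ) → Fin 2, IsLevelTest gaussDensity n α T →
      β < secondKindError (mixture gaussDensity (ε n) (μ₁ n) (μ₂ n)) T := by
  have hlim : Tendsto (fun n : ℕ => 1 - α -
      √(Real.exp (n * (ε n * (μ₂ n - μ₁ n) ^ 2) ^ 2) - 1)) atTop (𝓝 (1 - α - √(Real.exp 0 - 1))) :=
    tendsto_const_nhds.sub
      (((Real.continuous_exp.tendsto 0).comp (h.tendsto_sq_signal hb)).sub_const 1).sqrt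
  rw [Real.exp_zero, sub_self, Real.sqrt_zero, sub_zero] at hlim
  filter_upwards [hlim.eventually (lt_mem_nhds hβ),
    (h.tendsto_gap hr).eventually (ge_mem_nhds one_pos)] with n hn hgap T hT
  have := le_secondKindError (μ := μ₁ n) (h.eps_mem n) (sub_nonneg.2 (h.mean_lt n).le) hgap hT
  rw [add_sub_cancel] at this
  exact hn.trans_le this

end DenseRegime

/-! ### Chebyshev's inequality, Gaussian moments and the variance test. -/

/-- Chebyshev's inequality for the sum of a function over an i.i.d. sample. -/
lemma pi_real_le_abs_sum_sub {ν : Measure ℝ} [IsProbabilityMeasure ν] {g : ℝ → ℝ}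
    (hg : MemLp g 2 ν) (n : ℕ) {c : ℝ} (hc : 0 < c) :
    (Measure.pi fun _ : Fin n => ν).real {x | c ≤ |∑ i, g (x i) - n * ∫ y, g y ∂ν|} ≤
      n * (∫ y, g y ^ 2 ∂ν) / c ^ 2 := by
  set P := Measure.pi fun _ : Fin n => ν
  have hgi : ∀ i : Fin n, MemLp (fun x : Fin n → ℝ => g (x i)) 2 P := fun i =>
    hg.comp_measurePreserving (measurePreserving_eval (fun _ => ν) i)
  have hX : MemLp (∑ i : Fin n, fun x : Fin n → ℝ => g (x i)) 2 P :=
    memLp_finsetSum' _ fun i _ => hgi i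
  have hE : P[∑ i : Fin n, fun x : Fin n → ℝ => g (x i)] = n * ∫ y, g y ∂ν := by
    simp only [Finset.sum_apply]
    rw [integral_finsetSum _ fun i _ => (hgi i).integrable one_le_two]
    simp only [P, integral_comp_eval (μ := fun _ : Fin n => ν) hg.aestronglyMeasurable]
    simp
  have hV : Var[∑ i : Fin n, fun x : Fin n → ℝ => g (x i); P] ≤ n * ∫ y, g y ^ 2 ∂ν := by
    rw [variance_sum_pi fun _ => hg]
    simp only [Finset.sum_const, Finset.card_univ, Fintype.card_fin, nsmul_eq_mul]
    exact mul_le_mul_of_nonneg_left (variance_le_expectation_sq hg.aestronglyMeasurable)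
      (Nat.cast_nonneg n)
  have h := meas_ge_le_variance_div_sq hX hc
  rw [hE] at h
  simp only [Finset.sum_apply] at h
  refine (ENNReal.toReal_le_of_le_ofReal (div_nonneg (variance_nonneg _ _) (sq_nonneg c)) h).trans ?_
  gcongr

section GaussianMoments

lemma integrable_gaussianReal_iff (μ : ℝ) (g : ℝ → ℝ) :
    Integrable g (gaussianReal μ 1) ↔ Integrable (fun y => g (y + μ)) (gaussianReal 0 1) := by
  have h := gaussianReal_map_add_const (μ := 0) (v := 1) μ
  rw [zero_add] at h
  rw [← h, (measurableEmbedding_addRight μ).integrable_map_iff]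
  rfl

lemma integral_gaussianReal_eq (μ : ℝ) (g : ℝ → ℝ) :
    ∫ x, g x ∂gaussianReal μ 1 = ∫ y, g (y + μ) ∂gaussianReal 0 1 := by
  have h := gaussianReal_map_add_const (μ := 0) (v := 1) μ
  rw [zero_add] at h
  rw [← h, (measurableEmbedding_addRight μ).integral_map]

lemma memLp_four_add_const (a : ℝ) : MemLp (fun y : ℝ => y + a) 4 (gaussianReal 0 1) := by
  have := (memLp_id_gaussianReal (μ := 0) (v := 1) 4).add (memLp_const a)
  exact this

lemma integrable_add_const_pow_four (a : ℝ) :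
    Integrable (fun y : ℝ => (y + a) ^ 4) (gaussianReal 0 1) := by
  have h := (memLp_four_add_const a).integrable_norm_pow (p := 4) (by norm_num)
  refine h.congr (Eventually.of_forall fun y => ?_)
  simp [Real.norm_eq_abs, Even.pow_abs (by decide : Even 4)]

lemma integrable_add_const_sq (a : ℝ) :
    Integrable (fun y : ℝ => (y + a) ^ 2) (gaussianReal 0 1) :=
  ((memLp_four_add_const a).mono_exponent (p := 2) (by norm_num)).integrable_sq

lemma integrable_add_const (a : ℝ) : Integrable (fun y : ℝ => y + a) (gaussianReal 0 1) :=
  (memLp_four_add_const a).integrable (by norm_num)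

lemma integral_add_const (a : ℝ) : ∫ y, (y + a) ∂gaussianReal 0 1 = a := by
  have h := integrable_add_const 0
  simp only [add_zero] at h
  rw [integral_add h (integrable_const a), integral_id_gaussianReal]
  simp

lemma integral_add_const_sq (a : ℝ) : ∫ y, (y + a) ^ 2 ∂gaussianReal 0 1 = 1 + a ^ 2 := by
  have hm : MemLp (fun y : ℝ => y + a) 2 (gaussianReal 0 1) :=
    (memLp_four_add_const a).mono_exponent (by norm_num)
  have h := variance_eq_sub hm
  rw [variance_add_const (by fun_prop), variance_fun_id_gaussianReal, integral_add_const] at h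
  simp only [Pi.pow_apply, NNReal.coe_one] at h
  linarith

/-- A bound for the fourth moment of a Gaussian variable around a point at distance at most one
from its mean. -/
noncomputable def fourthMomentBound : ℝ := 8 * (∫ y, y ^ 4 ∂gaussianReal 0 1) + 8

lemma fourthMomentBound_pos : 0 < fourthMomentBound := by
  have : 0 ≤ ∫ y, y ^ 4 ∂gaussianReal 0 1 := integral_nonneg fun y => by positivity
  unfold fourthMomentBound
  linarith

lemma integral_add_const_pow_four_le {a : ℝ} (ha : |a| ≤ 1) :
    ∫ y, (y + a) ^ 4 ∂gaussianReal 0 1 ≤ fourthMomentBound := by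
  have h4 := integrable_add_const_pow_four 0
  simp only [add_zero] at h4
  have : ∫ y, (8 * y ^ 4 + 8) ∂gaussianReal 0 1 = fourthMomentBound := by
    rw [integral_add (h4.const_mul 8) (integrable_const _), integral_const_mul]
    simp [fourthMomentBound]
  rw [← this]
  refine integral_mono (integrable_add_const_pow_four a)
    ((h4.const_mul 8).add (integrable_const _)) fun y => ?_
  have h1 : a ^ 2 ≤ 1 := (sq_le_one_iff_abs_le_one a).2 ha
  have h2 : (y + a) ^ 2 ≤ 2 * y ^ 2 + 2 := by nlinarith [sq_nonneg (y - a)]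
  calc (y + a) ^ 4 = ((y + a) ^ 2) ^ 2 := by ring
    _ ≤ (2 * y ^ 2 + 2) ^ 2 := pow_le_pow_left₀ (sq_nonneg _) h2 2
    _ ≤ 8 * y ^ 4 + 8 := by nlinarith [sq_nonneg (y ^ 2 - 1)]

variable {ε Δ : ℝ} (μ : ℝ)

lemma integrable_gaussMix_of_forall {g : ℝ → ℝ} {m : ℝ}
    (h : ∀ a, Integrable (fun y => g (y + a)) (gaussianReal 0 1)) :
    Integrable (fun x => g (x - m)) (gaussMix ε μ (μ + Δ)) := by
  refine integrable_gaussMix ((integrable_gaussianReal_iff _ _).2 ?_)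
    ((integrable_gaussianReal_iff _ _).2 ?_) <;> simpa only [add_sub_assoc] using h _

lemma integral_gaussMix_sub_mean (hε : ε ∈ Set.Ioo (0 : ℝ) 1) {g : ℝ → ℝ}
    (h : ∀ a, Integrable (fun y => g (y + a)) (gaussianReal 0 1)) :
    ∫ x, g (x - (μ + ε * Δ)) ∂gaussMix ε μ (μ + Δ) =
      (1 - ε) * ∫ y, g (y + -(ε * Δ)) ∂gaussianReal 0 1 +
        ε * ∫ y, g (y + (1 - ε) * Δ) ∂gaussianReal 0 1 := by
  rw [integral_gaussMix hε ((integrable_gaussianReal_iff _ _).2 ?_)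
    ((integrable_gaussianReal_iff _ _).2 ?_), integral_gaussianReal_eq μ,
    integral_gaussianReal_eq (μ + Δ)]
  · congr! 5 <;> ring
  all_goals simpa only [add_sub_assoc] using h _

lemma integral_gaussMix_centered (hε : ε ∈ Set.Ioo (0 : ℝ) 1) :
    ∫ x, (x - (μ + ε * Δ)) ∂gaussMix ε μ (μ + Δ) = 0 := by
  rw [integral_gaussMix_sub_mean (g := fun y => y) μ hε integrable_add_const, integral_add_const,
    integral_add_const]
  ring

/-- Within-component variance plus the variance of the component means; the latter is the signal
that the variance test sees. -/
lemma integral_gaussMix_centered_sq (hε : ε ∈ Set.Ioo (0 : ℝ) 1) :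
    ∫ x, (x - (μ + ε * Δ)) ^ 2 ∂gaussMix ε μ (μ + Δ) = 1 + ε * (1 - ε) * Δ ^ 2 := by
  rw [integral_gaussMix_sub_mean (g := fun y => y ^ 2) μ hε integrable_add_const_sq,
    integral_add_const_sq, integral_add_const_sq]
  ring

lemma integral_gaussMix_centered_pow_four_le (hε : ε ∈ Set.Ioo (0 : ℝ) 1) (hΔ : 0 ≤ Δ)
    (hΔ1 : Δ ≤ 1) :
    ∫ x, ((x - (μ + ε * Δ)) ^ 2) ^ 2 ∂gaussMix ε μ (μ + Δ) ≤ fourthMomentBound := by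
  obtain ⟨h0, h1⟩ := hε
  simp only [← pow_mul]
  rw [integral_gaussMix_sub_mean (g := fun y => y ^ (2 * 2)) μ ⟨h0, h1⟩
    integrable_add_const_pow_four]
  have ha : |-(ε * Δ)| ≤ 1 := by
    rw [abs_neg, abs_of_nonneg (by positivity)]
    exact mul_le_one₀ h1.le hΔ hΔ1
  have hb : |(1 - ε) * Δ| ≤ 1 := by
    rw [abs_of_nonneg (mul_nonneg (by linarith) hΔ)]
    exact mul_le_one₀ (by linarith) hΔ hΔ1
  have := mul_le_mul_of_nonneg_left (integral_add_const_pow_four_le ha) (by linarith : 0 ≤ 1 - ε)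
  have := mul_le_mul_of_nonneg_left (integral_add_const_pow_four_le hb) h0.le
  norm_num at *
  linarith

end GaussianMoments

/-- A free centre `m` turns the statistic into sums of independent terms: `m = 0` under the null,
the mixture mean under the alternative. -/
lemma mul_empVar_eq {n : ℕ} (hn : 2 ≤ n) (x : Fin n → ℝ) (m : ℝ) :
    ((n : ℝ) - 1) * empVar x = ∑ i, (x i - m) ^ 2 - (∑ i, (x i - m)) ^ 2 / n := by
  have hn' : (2 : ℝ) ≤ n := by exact_mod_cast hn
  have h1 : (n : ℝ) - 1 ≠ 0 := by linarith
  have h0 : (n : ℝ) ≠ 0 := by linarith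
  have hS : ∑ i, x i = n * empMean x := by
    rw [empMean]; field_simp
  have h2 : ∑ i, (x i - m) = n * (empMean x - m) := by
    rw [Finset.sum_sub_distrib, hS]
    simp only [Finset.sum_const, Finset.card_univ, Fintype.card_fin, nsmul_eq_mul]
    ring
  have h3 : ∑ i, (x i - m) ^ 2 = ∑ i, (x i - empMean x) ^ 2 + n * (empMean x - m) ^ 2 := by
    have : ∀ i, (x i - m) ^ 2 = (x i - empMean x) ^ 2 + 2 * (empMean x - m) * x i +
        (m ^ 2 - empMean x ^ 2) := fun i => by ring
    simp only [this, Finset.sum_add_distrib, ← Finset.mul_sum, hS]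
    simp only [Finset.sum_const, Finset.card_univ, Fintype.card_fin, nsmul_eq_mul]
    ring
  rw [h2, h3, empVar]
  field_simp
  ring

/-- The subtracted square in `mul_empVar_eq` only helps from above, so one Chebyshev bound on `∑
xᵢ²` suffices; `hCα` makes its failure probability at most `α`. -/
lemma quantile_empVar_le {n : ℕ} (hn : 2 ≤ n) {α C : ℝ} (hα : α ∈ Set.Ioo (0 : ℝ) 1) (hC : 0 < C)
    (hCα : fourthMomentBound ≤ α * C ^ 2) :
    ((n : ℝ) - 1) * quantile (sampleLaw gaussDensity n) empVar (1 - α) ≤ n + C * √n := by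
  have hn' : (2 : ℝ) ≤ n := by exact_mod_cast hn
  have hn1 : (0 : ℝ) < n - 1 := by linarith
  have hn0 : (0 : ℝ) < n := by linarith
  rw [sampleLaw_gaussDensity, mul_comm, ← le_div_iff₀ hn1]
  set P := Measure.pi fun _ : Fin n => gaussianReal 0 1
  refine quantile_le (measurable_empVar n) (by linarith [hα.2]) ?_
  have hmem : MemLp (fun y : ℝ => y ^ 2) 2 (gaussianReal 0 1) := by
    rw [memLp_two_iff_integrable_sq (by fun_prop)]
    simpa [← pow_mul] using integrable_add_const_pow_four 0
  have hcheb := pi_real_le_abs_sum_sub hmem n (c := C * √n) (by positivity)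
  have hone : ∫ y : ℝ, y ^ 2 ∂gaussianReal 0 1 = 1 := by simpa using integral_add_const_sq 0
  have hfour : ∫ y : ℝ, (y ^ 2) ^ 2 ∂gaussianReal 0 1 ≤ fourthMomentBound := by
    simpa [← pow_mul] using integral_add_const_pow_four_le (a := 0) (by simp)
  rw [hone] at hcheb
  have hb : n * (∫ y : ℝ, (y ^ 2) ^ 2 ∂gaussianReal 0 1) / (C * √n) ^ 2 ≤ α := by
    rw [mul_pow, Real.sq_sqrt hn0.le, div_le_iff₀ (by positivity)]
    nlinarith
  have hsub : {x : Fin n → ℝ | empVar x ≤ (n + C * √n) / (n - 1)}ᶜ ⊆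
      {x | C * √n ≤ |∑ i, x i ^ 2 - n * 1|} := by
    intro x hx
    have hx : (n + C * √n) / (n - 1) < empVar x := not_le.1 hx
    rw [div_lt_iff₀ hn1, mul_comm (empVar x), mul_empVar_eq hn x 0] at hx
    simp only [sub_zero] at hx
    have : 0 ≤ (∑ i, x i) ^ 2 / n := by positivity
    rw [Set.mem_ofPred_eq]
    refine le_trans ?_ (le_abs_self _)
    linarith
  have := measureReal_mono (μ := P) hsub
  rw [probReal_compl_eq_one_sub (measurableSet_le (measurable_empVar n) measurable_const)] at this
  linarith

lemma secondKindError_varTest_le {α β : ℝ} (hα : α ∈ Set.Ioo (0 : ℝ) 1) (hβ : 0 < β) :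
    ∃ K : ℝ, ∀ n : ℕ, 2 ≤ n → ∀ ε Δ μ : ℝ, ε ∈ Set.Ioo (0 : ℝ) 1 → ε ≤ 1 / 2 → 0 ≤ Δ → Δ ≤ 1 →
      K ≤ √n * (ε * Δ ^ 2) →
      secondKindError (mixture gaussDensity ε μ (μ + Δ)) (varTest gaussDensity n α) ≤ β := by
  obtain ⟨C, hC, hCα⟩ : ∃ C : ℝ, 0 < C ∧ fourthMomentBound ≤ α * C ^ 2 := by
    refine ⟨√(fourthMomentBound / α), Real.sqrt_pos.2 (div_pos fourthMomentBound_pos hα.1), ?_⟩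
    rw [Real.sq_sqrt (div_pos fourthMomentBound_pos hα.1).le, mul_div_cancel₀ _ hα.1.ne']
  -- `D` gives each of the two Chebyshev events probability at most `β / 2`: the fourth moment bound
  -- serves the sum of squares, and the added `2` dominates the second moment needed for the linear
  -- sum.
  obtain ⟨D, hD, hDβ⟩ : ∃ D : ℝ, 0 < D ∧ fourthMomentBound + 2 = β / 2 * D ^ 2 := by
    have : 0 < (fourthMomentBound + 2) / (β / 2) := by
      have := fourthMomentBound_pos
      positivity
    refine ⟨√((fourthMomentBound + 2) / (β / 2)), Real.sqrt_pos.2 this, ?_⟩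
    rw [Real.sq_sqrt this.le]
    field_simp
  -- The signal must beat the null threshold `C√n`, the squared linear sum `D² ≤ D²√n` and the
  -- deviation `D√n`. The factor `2` pays for `1 - ε ≥ 1 / 2`.
  refine ⟨2 * (C + D ^ 2 + D), fun n hn ε Δ μ hε hε2 hΔ hΔ1 hK => ?_⟩
  have hn' : (2 : ℝ) ≤ n := by exact_mod_cast hn
  have hn0 : (0 : ℝ) < n := by linarith
  have hs1 : 1 ≤ √(n : ℝ) := Real.one_le_sqrt.2 (by linarith)
  have := isProbabilityMeasure_gaussMix hε μ (μ + Δ)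
  rw [secondKindError, sampleLaw_mixture hε]
  set ν := gaussMix ε μ (μ + Δ)
  set m := μ + ε * Δ with hm
  have hi1 := integrable_gaussMix_of_forall (ε := ε) (Δ := Δ) μ (g := fun y => y) (m := m)
    integrable_add_const
  have hi2 := integrable_gaussMix_of_forall (ε := ε) (Δ := Δ) μ (g := fun y => y ^ 2) (m := m)
    integrable_add_const_sq
  have hi4 := integrable_gaussMix_of_forall (ε := ε) (Δ := Δ) μ (g := fun y => y ^ 4) (m := m)
    integrable_add_const_pow_four
  have hL1 : MemLp (fun x => x - m) 2 ν := by
    rw [memLp_two_iff_integrable_sq (by fun_prop)]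
    exact hi2
  have hL2 : MemLp (fun x => (x - m) ^ 2) 2 ν := by
    rw [memLp_two_iff_integrable_sq (by fun_prop)]
    simpa [← pow_mul] using hi4
  have c1 := pi_real_le_abs_sum_sub hL1 n (c := D * √n) (by positivity)
  have c2 := pi_real_le_abs_sum_sub hL2 n (c := D * √n) (by positivity)
  rw [integral_gaussMix_centered μ hε, integral_gaussMix_centered_sq μ hε] at c1
  rw [integral_gaussMix_centered_sq μ hε] at c2
  have hσ : ε * (1 - ε) * Δ ^ 2 ≤ 1 := by
    have h1 : ε * (1 - ε) ≤ 1 := by nlinarith [hε.1]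
    exact mul_le_one₀ h1 (sq_nonneg _) (pow_le_one₀ hΔ hΔ1)
  have hden : (D * √n) ^ 2 = D ^ 2 * n := by rw [mul_pow, Real.sq_sqrt hn0.le]
  have b1 : n * (1 + ε * (1 - ε) * Δ ^ 2) / (D * √n) ^ 2 ≤ β / 2 := by
    rw [hden, div_le_iff₀ (by positivity), ← mul_assoc, ← hDβ]
    nlinarith [fourthMomentBound_pos]
  have b2 : n * (∫ x, ((x - m) ^ 2) ^ 2 ∂ν) / (D * √n) ^ 2 ≤ β / 2 := by
    rw [hden, div_le_iff₀ (by positivity), ← mul_assoc, ← hDβ]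
    nlinarith [integral_gaussMix_centered_pow_four_le μ hε hΔ hΔ1]
  have hsub : {x : Fin n → ℝ | varTest gaussDensity n α x = 0} ⊆
      {x | D * √n ≤ |∑ i, (x i - m) - n * 0|} ∪
      {x | D * √n ≤ |∑ i, (x i - m) ^ 2 - n * (1 + ε * (1 - ε) * Δ ^ 2)|} := by
    intro x hx
    have hx : empVar x ≤ quantile (sampleLaw gaussDensity n) empVar (1 - α) := by
      by_contra! hlt
      have hx : varTest gaussDensity n α x = 0 := hx
      rw [varTest, if_pos hlt] at hx
      exact one_ne_zero hx
    have hq := quantile_empVar_le hn hα hC hCα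
    have hle := (mul_le_mul_of_nonneg_left hx (by linarith : 0 ≤ (n : ℝ) - 1)).trans hq
    rw [mul_empVar_eq hn x m] at hle
    by_cases hA : D * √n ≤ |∑ i, (x i - m) - n * 0|
    · exact Or.inl hA
    right
    rw [mul_zero, sub_zero, not_le] at hA
    have hsq : (∑ i, (x i - m)) ^ 2 / n ≤ D ^ 2 := by
      rw [div_le_iff₀ hn0, ← hden, ← sq_abs]
      exact pow_le_pow_left₀ (abs_nonneg _) hA.le 2
    have hsig : (C + D ^ 2 + D) * √n ≤ n * (ε * (1 - ε) * Δ ^ 2) := by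
      have h1 : C + D ^ 2 + D ≤ √n * (ε * (1 - ε) * Δ ^ 2) := by
        have : 0 ≤ √n * (ε * Δ ^ 2) := by have := hε.1; positivity
        nlinarith
      calc (C + D ^ 2 + D) * √n ≤ √n * (ε * (1 - ε) * Δ ^ 2) * √n := by gcongr
        _ = (√n * √n) * (ε * (1 - ε) * Δ ^ 2) := by ring
        _ = _ := by rw [Real.mul_self_sqrt hn0.le]
    have hD2 : D ^ 2 ≤ D ^ 2 * √n := le_mul_of_one_le_right (sq_nonneg D) hs1
    rw [Set.mem_ofPred_eq, abs_sub_comm]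
    refine le_trans ?_ (le_abs_self _)
    linarith
  refine (measureReal_mono hsub).trans ((measureReal_union_le _ _).trans ?_)
  linarith

/-! ### Strong convexity of the Gaussian tail. -/

/-- The upper tail function of the standard Gaussian law. -/
noncomputable def gaussTail (t : ℝ) : ℝ := (gaussianReal 0 1).real (Set.Ioi t)

lemma gaussDensity_pos (x : ℝ) : 0 < gaussDensity x := gaussianPDFReal_pos 0 1 x one_ne_zero

lemma gaussDensity_eq :
    gaussDensity = fun x => (√(2 * Real.pi))⁻¹ * Real.exp (-x ^ 2 / 2) := by
  funext x
  simp [gaussDensity, gaussianPDFReal]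

lemma hasDerivAt_gaussDensity (x : ℝ) : HasDerivAt gaussDensity (-(x * gaussDensity x)) x := by
  rw [gaussDensity_eq]
  have h : HasDerivAt (fun x : ℝ => -x ^ 2 / 2) (-x) x := by
    refine (((hasDerivAt_pow 2 x).fun_neg).div_const 2).congr_deriv ?_
    norm_num
    ring
  refine (h.exp.const_mul (√(2 * Real.pi))⁻¹).congr_deriv ?_
  ring

lemma continuous_gaussDensity : Continuous gaussDensity :=
  continuous_iff_continuousAt.2 fun x => (hasDerivAt_gaussDensity x).continuousAt

lemma gaussDensity_anti {x y : ℝ} (hx : 0 ≤ x) (hxy : x ≤ y) : gaussDensity y ≤ gaussDensity x := by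
  simp only [gaussDensity_eq]
  gcongr

lemma gaussTail_eq_integral (t : ℝ) : gaussTail t = ∫ x in Set.Ioi t, gaussDensity x := by
  rw [gaussTail, measureReal_def, gaussianReal_apply_eq_integral 0 one_ne_zero,
    ENNReal.toReal_ofReal (integral_nonneg fun x => gaussianPDFReal_nonneg 0 1 x)]
  rfl

lemma integrable_gaussDensity : Integrable gaussDensity := integrable_gaussianPDFReal 0 1

lemma hasDerivAt_gaussTail (t : ℝ) : HasDerivAt gaussTail (-gaussDensity t) t := by
  have h : gaussTail = fun t => gaussTail 0 - ∫ x in (0 : ℝ)..t, gaussDensity x := by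
    funext t
    rw [gaussTail_eq_integral t, gaussTail_eq_integral 0,
      ← intervalIntegral.integral_interval_add_Ioi integrable_gaussDensity.integrableOn
        (integrable_gaussDensity.integrableOn (s := Set.Ioi t)) (a := 0)]
    ring
  rw [h]
  exact (intervalIntegral.integral_hasDerivAt_right
    (continuous_gaussDensity.intervalIntegrable _ _)
    (continuous_gaussDensity.stronglyMeasurableAtFilter _ _)
    continuous_gaussDensity.continuousAt).const_sub _

lemma continuous_gaussTail : Continuous gaussTail :=
  continuous_iff_continuousAt.2 fun x => (hasDerivAt_gaussTail x).continuousAt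

lemma gaussTail_eq_one_sub_cdf (t : ℝ) : gaussTail t = 1 - cdf (gaussianReal 0 1) t := by
  rw [gaussTail, cdf_eq_real, ← probReal_compl_eq_one_sub measurableSet_Iic, Set.compl_Iic]

lemma tendsto_gaussTail_atTop : Tendsto gaussTail atTop (𝓝 0) := by
  have := (tendsto_cdf_atTop (gaussianReal 0 1)).const_sub 1
  rw [sub_self] at this
  exact this.congr fun t => (gaussTail_eq_one_sub_cdf t).symm

lemma gaussianReal_real_Ioi (μ t : ℝ) :
    (gaussianReal μ 1).real (Set.Ioi t) = gaussTail (t - μ) := by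
  have h := gaussianReal_map_add_const (μ := 0) (v := 1) μ
  rw [zero_add] at h
  rw [← h, map_measureReal_apply (by fun_prop) measurableSet_Ioi, gaussTail]
  congr 1
  ext x
  simp [sub_lt_iff_lt_add]

lemma gaussianReal_real_Iio (μ t : ℝ) :
    (gaussianReal μ 1).real (Set.Iio t) = gaussTail (μ - t) := by
  have h := gaussianReal_map_neg (μ := -μ) (v := 1)
  rw [neg_neg] at h
  rw [← h, map_measureReal_apply (by fun_prop) measurableSet_Iio]
  have : (fun x : ℝ => -x) ⁻¹' Set.Iio t = Set.Ioi (-t) := by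
    ext x
    simp
  rw [this, gaussianReal_real_Ioi]
  congr 1
  ring

lemma gaussTail_zero : gaussTail 0 = 1 / 2 := by
  have h1 := gaussianReal_real_Iio 0 0
  have : NullSingletonClass (gaussianReal 0 1) := nullSingletonClass_gaussianReal one_ne_zero
  have h2 : (gaussianReal 0 1).real (Set.Iio 0) = (gaussianReal 0 1).real (Set.Iic 0) :=
    measureReal_congr Iio_ae_eq_Iic
  rw [h2, ← cdf_eq_real, sub_self] at h1
  linarith [gaussTail_eq_one_sub_cdf 0]

/-- The second derivative of the tail is `x φ(x)`, which is at least `a φ(b)` on `[a, b]` as `φ`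
decreases there. -/
lemma strongConvexOn_gaussTail {a b : ℝ} (ha : 0 < a) :
    StrongConvexOn (Set.Icc a b) (a * gaussDensity b) gaussTail := by
  rw [strongConvexOn_iff_convex]
  set c := a * gaussDensity b with hc
  have h1 : ∀ x, HasDerivAt (fun x => gaussTail x - c / 2 * ‖x‖ ^ 2)
      (-gaussDensity x - c * x) x := fun x => by
    simp only [Real.norm_eq_abs, sq_abs]
    refine ((hasDerivAt_gaussTail x).fun_sub ((hasDerivAt_pow 2 x).const_mul (c / 2))).congr_deriv ?_
    norm_num
    ring
  have h2 : ∀ x, HasDerivAt (fun x => -gaussDensity x - c * x) (x * gaussDensity x - c) x :=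
    fun x => by
      refine ((hasDerivAt_gaussDensity x).fun_neg.fun_sub
        ((hasDerivAt_id x).const_mul c)).congr_deriv ?_
      ring
  have hd : deriv (fun x => gaussTail x - c / 2 * ‖x‖ ^ 2) = fun x => -gaussDensity x - c * x :=
    funext fun x => (h1 x).deriv
  refine convexOn_of_deriv2_nonneg' (convex_Icc a b)
    (fun x _ => (h1 x).differentiableAt.differentiableWithinAt) ?_ ?_
  · rw [hd]
    exact fun x _ => (h2 x).differentiableAt.differentiableWithinAt
  · intro x hx
    rw [Function.iterate_succ, Function.iterate_one, Function.comp_apply, hd, (h2 x).deriv, hc]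
    have := gaussDensity_anti (ha.le.trans hx.1) hx.2
    have := mul_le_mul hx.1 this (gaussDensity_pos b).le (ha.le.trans hx.1)
    linarith

lemma gaussTail_add_le {a b x y ε : ℝ} (ha : 0 < a) (hx : x ∈ Set.Icc a b) (hy : y ∈ Set.Icc a b)
    (hε : ε ∈ Set.Ioo (0 : ℝ) 1) :
    gaussTail ((1 - ε) * x + ε * y) + a * gaussDensity b / 2 * (ε * (1 - ε) * (x - y) ^ 2) ≤
      (1 - ε) * gaussTail x + ε * gaussTail y := by
  have := (strongConvexOn_gaussTail (b := b) ha).2 hx hy (by linarith [hε.2] : 0 ≤ 1 - ε) hε.1.le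
    (by ring)
  simp only [smul_eq_mul, Real.norm_eq_abs, sq_abs] at this
  linarith

/-- Each mixture tail averages `gaussTail` at two points at distance `Δ`. Since the centre is the
mixture mean, their weighted average is `t` on both sides, and strong convexity gives the same gain
for both tails. -/
lemma gaussMix_real_tails_ge {a b t ε Δ : ℝ} (μ : ℝ) (ha : 0 < a) (hε : ε ∈ Set.Ioo (0 : ℝ) 1)
    (hΔ : 0 ≤ Δ) (hta : a ≤ t - Δ) (htb : t + Δ ≤ b) :
    gaussTail t + a * gaussDensity b / 2 * (ε * (1 - ε) * Δ ^ 2) ≤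
        (gaussMix ε μ (μ + Δ)).real (Set.Ioi (μ + ε * Δ + t)) ∧
      gaussTail t + a * gaussDensity b / 2 * (ε * (1 - ε) * Δ ^ 2) ≤
        (gaussMix ε μ (μ + Δ)).real (Set.Iio (μ + ε * Δ - t)) := by
  obtain ⟨h0, h1⟩ := hε
  have e1 : ε * Δ ≤ Δ := mul_le_of_le_one_left hΔ h1.le
  have e0 : 0 ≤ ε * Δ := by positivity
  constructor
  · have h := gaussTail_add_le (b := b) (x := t + ε * Δ) (y := t - (1 - ε) * Δ) ha
      ⟨by linarith, by linarith⟩ ⟨by linarith, by linarith⟩ ⟨h0, h1⟩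
    rw [gaussMix_real_apply ⟨h0, h1⟩, gaussianReal_real_Ioi, gaussianReal_real_Ioi]
    convert h using 3 <;> ring_nf
  · have h := gaussTail_add_le (b := b) (x := t - ε * Δ) (y := t + (1 - ε) * Δ) ha
      ⟨by linarith, by linarith⟩ ⟨by linarith, by linarith⟩ ⟨h0, h1⟩
    rw [gaussMix_real_apply ⟨h0, h1⟩, gaussianReal_real_Iio, gaussianReal_real_Iio]
    convert h using 3 <;> ring_nf

/-! ### Order statistics through counts of exceedances. -/

section Counting

variable {n k : ℕ}

lemma sum_indicator_one_eq_card (s : Set ℝ) [DecidablePred (· ∈ s)] (x : Fin n → ℝ) :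
    ∑ i, s.indicator (1 : ℝ → ℝ) (x i) = (Finset.univ.filter fun i => x i ∈ s).card := by
  simp [Set.indicator_apply]

/-- Recasts the event as a bound on a sum of i.i.d. indicators, the form to which Chebyshev's
inequality applies. -/
lemma lt_orderStat_iff (h1 : 1 ≤ k) (hk : k ≤ n) (x : Fin n → ℝ) (t : ℝ) :
    t < orderStat x (n - k + 1) ↔ (k : ℝ) ≤ ∑ i, (Set.Ioi t).indicator (1 : ℝ → ℝ) (x i) := by
  rw [← not_le, orderStat_le_iff (by omega) (by omega), sum_indicator_one_eq_card, Nat.cast_le]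
  have h := Finset.card_filter_add_card_filter_not (s := (Finset.univ : Finset (Fin n)))
    (fun i => x i ≤ t)
  simp only [not_le, Finset.card_univ, Fintype.card_fin] at h
  simp only [Set.mem_Ioi]
  omega

lemma orderStat_lt_iff (h1 : 1 ≤ k) (hk : k ≤ n) (x : Fin n → ℝ) (t : ℝ) :
    orderStat x k < t ↔ (k : ℝ) ≤ ∑ i, (Set.Iio t).indicator (1 : ℝ → ℝ) (x i) := by
  rw [sum_indicator_one_eq_card, Nat.cast_le]
  have h : 1 ≤ k ∧ k ≤ n := ⟨h1, hk⟩
  have hs := Tuple.lt_card_lt_iff_apply_lt_of_monotone (a := t) (j := ⟨k - 1, by omega⟩)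
    (Tuple.monotone_sort x)
  have hc : (Finset.univ.filter fun i => (x ∘ Tuple.sort x) i < t).card =
      (Finset.univ.filter fun i => x i < t).card :=
    Finset.card_equiv (Tuple.sort x) (by simp)
  rw [hc, Function.comp_apply] at hs
  rw [orderStat, dif_pos h, ← hs]
  simp only [Set.mem_Iio]
  omega

lemma pi_real_le_abs_count_sub {ν : Measure ℝ} [IsProbabilityMeasure ν] {s : Set ℝ}
    (hs : MeasurableSet s) (hn : 0 < n) {d : ℝ} (hd : 0 < d) :
    (Measure.pi fun _ : Fin n => ν).real
      {x | n * d ≤ |∑ i, s.indicator (1 : ℝ → ℝ) (x i) - n * ν.real s|} ≤ 1 / (n * d ^ 2) := by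
  have hn' : (0 : ℝ) < n := by exact_mod_cast hn
  have hm : MemLp (s.indicator (1 : ℝ → ℝ)) 2 ν := (memLp_const (1 : ℝ)).indicator hs
  have h := pi_real_le_abs_sum_sub hm n (c := n * d) (by positivity)
  rw [integral_indicator_one hs] at h
  have hsq : ∀ y, s.indicator (1 : ℝ → ℝ) y ^ 2 = s.indicator (1 : ℝ → ℝ) y := fun y => by
    by_cases hy : y ∈ s <;> simp [hy]
  simp only [hsq] at h
  rw [integral_indicator_one hs] at h
  refine h.trans ?_
  rw [div_le_div_iff₀ (by positivity) (by positivity)]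
  have : ν.real s ≤ 1 := measureReal_le_one
  calc n * ν.real s * (n * d ^ 2) ≤ n * 1 * (n * d ^ 2) := by gcongr
    _ = 1 * (n * d) ^ 2 := by ring

/-- A spacing above `2t` forces the upper statistic above `t` or the lower one below `-t`; either
puts at least `k` points in a tail with expected count at most `k - nd`. -/
lemma pi_gaussianReal_real_lt_spacing_le (h1 : 1 ≤ k) (hk : 2 * k ≤ n) {t d : ℝ} (hd : 0 < d)
    (ht : n * (gaussTail t + d) ≤ k) :
    (Measure.pi fun _ : Fin n => gaussianReal 0 1).real {x | 2 * t < spacing k x} ≤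
      2 / (n * d ^ 2) := by
  have c1 := pi_real_le_abs_count_sub (n := n) (ν := gaussianReal 0 1)
    (measurableSet_Ioi (a := t)) (by omega) hd
  have c2 := pi_real_le_abs_count_sub (n := n) (ν := gaussianReal 0 1)
    (measurableSet_Iio (a := -t)) (by omega) hd
  rw [gaussianReal_real_Ioi, sub_zero] at c1
  rw [gaussianReal_real_Iio, zero_sub, neg_neg] at c2
  refine (measureReal_mono (fun x hx => ?_)).trans
    ((measureReal_union_le _ _).trans ((add_le_add c1 c2).trans_eq (by ring)))
  have hx : 2 * t < orderStat x (n - k + 1) - orderStat x k := hx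
  by_cases h : t < orderStat x (n - k + 1)
  · left
    rw [lt_orderStat_iff h1 (by omega)] at h
    rw [Set.mem_ofPred_eq]
    refine le_trans ?_ (le_abs_self _)
    linarith
  · right
    have h : orderStat x k < -t := by linarith
    rw [orderStat_lt_iff h1 (by omega)] at h
    rw [Set.mem_ofPred_eq]
    refine le_trans ?_ (le_abs_self _)
    linarith

/-- Conversely, a spacing of at most `2t` leaves fewer than `k` points in one of the tails beyond `m
± t`, although each has expected count at least `k + nd`. -/
lemma pi_real_spacing_le_le {ν : Measure ℝ} [IsProbabilityMeasure ν] (h1 : 1 ≤ k)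
    (hk : 2 * k ≤ n) {m t d : ℝ} (hd : 0 < d) (ht1 : k ≤ n * (ν.real (Set.Ioi (m + t)) - d))
    (ht2 : k ≤ n * (ν.real (Set.Iio (m - t)) - d)) :
    (Measure.pi fun _ : Fin n => ν).real {x | spacing k x ≤ 2 * t} ≤ 2 / (n * d ^ 2) := by
  have c1 := pi_real_le_abs_count_sub (n := n) (ν := ν)
    (measurableSet_Ioi (a := m + t)) (by omega) hd
  have c2 := pi_real_le_abs_count_sub (n := n) (ν := ν)
    (measurableSet_Iio (a := m - t)) (by omega) hd
  refine (measureReal_mono (fun x hx => ?_)).trans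
    ((measureReal_union_le _ _).trans ((add_le_add c1 c2).trans_eq (by ring)))
  have hx : orderStat x (n - k + 1) - orderStat x k ≤ 2 * t := hx
  by_cases h : m + t < orderStat x (n - k + 1)
  · right
    have h : ¬ orderStat x k < m - t := by linarith
    rw [orderStat_lt_iff h1 (by omega), not_le] at h
    rw [Set.mem_ofPred_eq, abs_sub_comm]
    refine le_trans ?_ (le_abs_self _)
    linarith
  · left
    rw [lt_orderStat_iff h1 (by omega), not_le] at h
    rw [Set.mem_ofPred_eq, abs_sub_comm]
    refine le_trans ?_ (le_abs_self _)
    linarith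

end Counting

/-! ### Power of the spacing test. -/

lemma exists_two_pow_between {n : ℕ} (hn : 4 ≤ n) : ∃ j : ℕ, 4 * 2 ^ j ≤ n ∧ n < 8 * 2 ^ j := by
  refine ⟨Nat.log 2 (n / 4), ?_, ?_⟩
  · have := Nat.pow_log_le_self 2 (x := n / 4) (by omega)
    omega
  · have := Nat.lt_pow_succ_log_self (b := 2) (by norm_num) (n / 4)
    rw [pow_succ] at this
    omega

/-- By Bonferroni the corrected level is at least `α / log₂ n`, so `hdα` places the null threshold
for this `k` below `2t`. Acceptance by the multiple test entails acceptance at this single `k`. -/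
lemma secondKindError_orderTest_le {n k : ℕ} (hn : 2 ≤ n) (hk : k ∈ dyadicSet n) {α : ℝ}
    (hα : α ∈ Set.Ioo (0 : ℝ) 1) {t d m : ℝ} {ε μ₁ μ₂ : ℝ} (hε : ε ∈ Set.Ioo (0 : ℝ) 1)
    (hd : 0 < d) (hdα : 2 / (n * d ^ 2) ≤ α / Real.logb 2 n) (ht : n * (gaussTail t + d) ≤ k)
    (ht1 : k ≤ n * ((gaussMix ε μ₁ μ₂).real (Set.Ioi (m + t)) - d))
    (ht2 : k ≤ n * ((gaussMix ε μ₁ μ₂).real (Set.Iio (m - t)) - d)) :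
    secondKindError (mixture gaussDensity ε μ₁ μ₂) (orderTest gaussDensity n α) ≤
      2 / (n * d ^ 2) := by
  obtain ⟨h1, h2⟩ := bounds_of_mem_dyadicSet hn hk
  obtain ⟨b1, b2, -⟩ := correctedLevel_bounds hn hα
  have := isProbabilityMeasure_gaussMix hε μ₁ μ₂
  have hcard : (0 : ℝ) < (dyadicSet n).card := by exact_mod_cast (dyadicSet_nonempty n).card_pos
  have hq : spacingQuantile gaussDensity n (correctedLevel gaussDensity n α) k ≤ 2 * t := by
    rw [spacingQuantile, sampleLaw_gaussDensity]
    refine quantile_le (measurable_spacing h1 h2) (by linarith [hα.2]) ?_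
    have h := (pi_gaussianReal_real_lt_spacing_le h1 h2 hd ht).trans (hdα.trans
      ((div_le_div_of_nonneg_left hα.1.le hcard (card_dyadicSet_le hn)).trans b1))
    have hc : {x : Fin n → ℝ | 2 * t < spacing k x} = {x | spacing k x ≤ 2 * t}ᶜ := by
      ext x; simp
    rw [hc, probReal_compl_eq_one_sub (measurableSet_le (measurable_spacing h1 h2)
      measurable_const)] at h
    linarith
  rw [secondKindError, sampleLaw_mixture hε]
  refine (measureReal_mono fun x hx => ?_).trans (pi_real_spacing_le_le h1 h2 hd ht1 ht2)
  classical
  rw [Set.mem_ofPred_eq, orderTest_eq_ite] at hx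
  rw [Set.mem_ofPred_eq]
  by_contra! hlt
  refine one_ne_zero ((if_pos ?_).symm.trans hx)
  exact ⟨k, hk, hq.trans_lt hlt⟩

lemma exists_secondKindError_orderTest_le {α : ℝ} (hα : α ∈ Set.Ioo (0 : ℝ) 1) :
    ∃ a c : ℝ, 0 < a ∧ 0 < c ∧ ∀ n : ℕ, 4 ≤ n → ∀ ε Δ μ d : ℝ, ε ∈ Set.Ioo (0 : ℝ) 1 →
      ε ≤ 1 / 2 → 0 ≤ Δ → Δ ≤ a → 0 < d → d ≤ 1 / 16 → 2 * d ≤ c * (ε * Δ ^ 2) →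
      2 / (n * d ^ 2) ≤ α / Real.logb 2 n →
      secondKindError (mixture gaussDensity ε μ (μ + Δ)) (orderTest gaussDensity n α) ≤
        2 / (n * d ^ 2) := by
  obtain ⟨a', ha', haQ⟩ : ∃ a' : ℝ, 0 < a' ∧ 1 / 4 < gaussTail a' := by
    have h : ∀ᶠ t in 𝓝[>] (0 : ℝ), 1 / 4 < gaussTail t :=
      (continuous_gaussTail.tendsto 0).mono_left nhdsWithin_le_nhds |>.eventually
        (lt_mem_nhds (by rw [gaussTail_zero]; norm_num))
    obtain ⟨t, ht, ht0⟩ := (h.and self_mem_nhdsWithin).exists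
    exact ⟨t, ht0, ht⟩
  obtain ⟨b', hb', hbQ⟩ : ∃ b' : ℝ, a' ≤ b' ∧ gaussTail b' < 1 / 16 :=
    ((eventually_ge_atTop a').and
      (tendsto_gaussTail_atTop.eventually (gt_mem_nhds (by norm_num)))).exists
  -- Halving leaves room for the shift: `t ∈ [a', b']` and `Δ ≤ a` keep `t - Δ` above `a` and `t +
  -- Δ` below `b' + a`.
  set a := a' / 2 with ha
  have ha0 : 0 < a := by positivity
  have hκ := mul_pos ha0 (gaussDensity_pos (b' + a))
  refine ⟨a, a * gaussDensity (b' + a) / 4, ha0, by positivity, ?_⟩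
  intro n hn ε Δ μ d hε hε2 hΔ hΔa hd hd16 hsig hdα
  have hn0 : (0 : ℝ) < n := by exact_mod_cast (by omega : 0 < n)
  obtain ⟨j, hj1, hj2⟩ := exists_two_pow_between hn
  have hk := two_pow_mem_dyadicSet (n := n) (j := j) (by omega) (by omega)
  set k := 2 ^ j
  have hk1 : (k : ℝ) / n ≤ 1 / 4 := by
    rw [div_le_div_iff₀ hn0 (by norm_num)]
    exact_mod_cast (by omega : k * 4 ≤ 1 * n)
  have hk2 : 1 / 8 < (k : ℝ) / n := by
    rw [div_lt_div_iff₀ (by norm_num) hn0]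
    exact_mod_cast (by omega : 1 * n < k * 8)
  -- The choice of `t` leaves the slack `d` under the null; the alternative must exceed `k / n` by
  -- `d`, hence the required gain `2d`. Since `1/8 < k/n ≤ 1/4` and `0 < d ≤ 1/16`, the target lies
  -- strictly between `1/16` and `1/4`.
  obtain ⟨t, ⟨hta, htb⟩, htQ⟩ : ∃ t ∈ Set.Icc a' b', gaussTail t = k / n - d :=
    intermediate_value_Icc' hb' continuous_gaussTail.continuousOn ⟨by linarith, by linarith⟩
  obtain ⟨g1, g2⟩ := gaussMix_real_tails_ge (b := b' + a) (t := t) μ ha0 hε hΔ (by linarith)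
    (by linarith)
  have hgain : 2 * d ≤ a * gaussDensity (b' + a) / 2 * (ε * (1 - ε) * Δ ^ 2) := by
    refine hsig.trans ?_
    have : ε * Δ ^ 2 ≤ 2 * (ε * (1 - ε) * Δ ^ 2) := by
      have : 0 ≤ ε * Δ ^ 2 := by have := hε.1; positivity
      nlinarith
    nlinarith
  have hkn : (k : ℝ) = n * (k / n) := by field_simp
  refine secondKindError_orderTest_le (m := μ + ε * Δ) (t := t) (by omega) hk hα hε hd hdα ?_ ?_ ?_
  · rw [htQ, sub_add_cancel, ← hkn]
  · rw [hkn]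
    gcongr
    linarith
  · rw [hkn]
    gcongr
    linarith

/-! ### Asymptotics below the boundary. -/

namespace DenseRegime

variable {δ r : ℝ} {ε μ₁ μ₂ : ℕ → ℝ}

lemma tendsto_rpow_mul_signal (h : DenseRegime δ r ε μ₁ μ₂) {τ : ℝ} (hτ : δ + 2 * r < τ) :
    Tendsto (fun n : ℕ => (n : ℝ) ^ τ * (ε n * (μ₂ n - μ₁ n) ^ 2)) atTop atTop := by
  have h0 := (tendsto_rpow_atTop (y := τ - (δ + 2 * r)) (by linarith)).comp
    tendsto_natCast_atTop_atTop
  refine (h.tendsto_signal.pos_mul_atTop one_pos h0).congr' ?_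
  filter_upwards [eventually_gt_atTop 0] with n hn
  have hn' : (0 : ℝ) < n := by exact_mod_cast hn
  simp only [Function.comp]
  rw [sub_eq_add_neg τ, Real.rpow_add hn']
  have : (0 : ℝ) < (n : ℝ) ^ (-(δ + 2 * r)) := Real.rpow_pos_of_pos hn' _
  field_simp

lemma eventually_secondKindError_le (h : DenseRegime δ r ε μ₁ μ₂) (hδ : 0 < δ) (hr : 0 < r)
    (hb : r < 1 / 4 - δ / 2) {α β : ℝ} (hα : α ∈ Set.Ioo (0 : ℝ) 1) (hβ : 0 < β) :
    ∀ᶠ n : ℕ in atTop,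
      secondKindError (mixture gaussDensity (ε n) (μ₁ n) (μ₂ n)) (orderTest gaussDensity n α) ≤ β ∧
      secondKindError (mixture gaussDensity (ε n) (μ₁ n) (μ₂ n)) (varTest gaussDensity n α) ≤ β := by
  obtain ⟨K, hK⟩ := secondKindError_varTest_le hα hβ
  obtain ⟨a, c, ha, hc, hO⟩ := exists_secondKindError_orderTest_le hα
  -- The precision is `d = n^{-τ}`: `τ > δ + 2r` makes it negligible against the signal, while `τ <
  -- 1/2` makes the error `2n^{-(1-2τ)}` polynomially small, hence eventually below both `β` and `α
  -- / log₂ n`.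
  obtain ⟨τ, hτ1, hτ2⟩ := exists_between (show δ + 2 * r < 1 / 2 by linarith)
  have hτ0 : 0 < τ := by linarith
  have hγ : 0 < 1 - 2 * τ := by linarith
  have hpow : Tendsto (fun n : ℕ => (n : ℝ) ^ (-τ)) atTop (𝓝 0) :=
    (tendsto_rpow_neg_atTop hτ0).comp tendsto_natCast_atTop_atTop
  have hinv : Tendsto (fun n : ℕ => 2 * (n : ℝ) ^ (-(1 - 2 * τ))) atTop (𝓝 0) := by
    simpa using ((tendsto_rpow_neg_atTop hγ).comp tendsto_natCast_atTop_atTop).const_mul (2 : ℝ)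
  have hlog : Tendsto (fun n : ℕ => 2 / Real.log 2 * (Real.log n / (n : ℝ) ^ (1 - 2 * τ))) atTop
      (𝓝 0) := by
    simpa using (((isLittleO_log_rpow_atTop hγ).tendsto_div_nhds_zero).comp
      tendsto_natCast_atTop_atTop).const_mul (2 / Real.log 2)
  filter_upwards [eventually_ge_atTop 4, (h.tendsto_eps hδ).eventually (ge_mem_nhds one_half_pos),
    (h.tendsto_gap hr).eventually (ge_mem_nhds one_pos),
    (h.tendsto_gap hr).eventually (ge_mem_nhds ha),
    hpow.eventually (ge_mem_nhds (by norm_num : (0 : ℝ) < 1 / 16)),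
    hinv.eventually (ge_mem_nhds hβ), hlog.eventually (ge_mem_nhds hα.1),
    (h.tendsto_rpow_mul_signal (τ := 1 / 2) (by linarith)).eventually_ge_atTop K,
    (h.tendsto_rpow_mul_signal hτ1).eventually_ge_atTop (2 / c)]
    with n hn hε hΔ1 hΔa hd hdβ hdlog hKn hcn
  have hn' : (4 : ℝ) ≤ n := by exact_mod_cast hn
  have hn0 : (0 : ℝ) < n := by linarith
  have hμ : μ₂ n = μ₁ n + (μ₂ n - μ₁ n) := by ring
  have hΔ0 : 0 ≤ μ₂ n - μ₁ n := sub_nonneg.2 (h.mean_lt n).le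
  have hdpos : (0 : ℝ) < (n : ℝ) ^ (-τ) := Real.rpow_pos_of_pos hn0 _
  have hnd : n * ((n : ℝ) ^ (-τ)) ^ 2 = (n : ℝ) ^ (1 - 2 * τ) := by
    rw [← Real.rpow_natCast _ 2, ← Real.rpow_mul hn0.le]
    nth_rewrite 1 [← Real.rpow_one (n : ℝ)]
    rw [← Real.rpow_add hn0]
    congr 1
    push_cast
    ring
  have hlogn : 0 < Real.log n := Real.log_pos (by linarith)
  have hlog2 : 0 < Real.log 2 := Real.log_pos (by norm_num)
  have hnγ : (0 : ℝ) < (n : ℝ) ^ (1 - 2 * τ) := Real.rpow_pos_of_pos hn0 _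
  rw [hμ]
  constructor
  · refine (hO n hn (ε n) _ (μ₁ n) ((n : ℝ) ^ (-τ)) (h.eps_mem n) hε hΔ0 hΔa hdpos hd ?_ ?_).trans ?_
    · rw [div_le_iff₀ hc] at hcn
      have e : (n : ℝ) ^ (-τ) * (n : ℝ) ^ τ = 1 := by
        rw [← Real.rpow_add hn0, neg_add_cancel, Real.rpow_zero]
      calc 2 * (n : ℝ) ^ (-τ) ≤
          ((n : ℝ) ^ τ * (ε n * (μ₂ n - μ₁ n) ^ 2) * c) * (n : ℝ) ^ (-τ) := by gcongr
        _ = c * (ε n * (μ₂ n - μ₁ n) ^ 2) * ((n : ℝ) ^ (-τ) * (n : ℝ) ^ τ) := by ring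
        _ = _ := by rw [e, mul_one]
    · rw [hnd, Real.logb, div_le_div_iff₀ hnγ (div_pos hlogn hlog2)]
      calc 2 * (Real.log n / Real.log 2) =
          2 / Real.log 2 * (Real.log n / (n : ℝ) ^ (1 - 2 * τ)) * (n : ℝ) ^ (1 - 2 * τ) := by
            field_simp
        _ ≤ α * (n : ℝ) ^ (1 - 2 * τ) := by gcongr
    · rw [hnd, div_eq_mul_inv, ← Real.rpow_neg hn0.le]
      exact hdβ
  · refine hK n (by omega) (ε n) _ (μ₁ n) (h.eps_mem n) hε hΔ0 hΔ1 ?_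
    rw [Real.sqrt_eq_rpow]
    exact hKn

end DenseRegime

end MixtureDetection

theorem mainTheorem7 (α β δ r : ℝ)
    (hα : α ∈ Set.Ioo (0 : ℝ) 1) (hβ : β ∈ Set.Ioo (0 : ℝ) (1 - α))
    (hδ : δ ∈ Set.Ioc (0 : ℝ) (1 / 2)) (hr : r ∈ Set.Ioo (0 : ℝ) (1 / 2)) :
    -- both procedures are level-α tests
    (∀ n : ℕ, 2 ≤ n →
      MixtureDetection.IsLevelTest MixtureDetection.gaussDensity n α
          (MixtureDetection.orderTest MixtureDetection.gaussDensity n α) ∧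
      MixtureDetection.IsLevelTest MixtureDetection.gaussDensity n α
          (MixtureDetection.varTest MixtureDetection.gaussDensity n α)) ∧
    -- below the boundary both of them detect the mixture
    (r < 1 / 4 - δ / 2 → ∀ ε μ₁ μ₂ : ℕ → ℝ, MixtureDetection.DenseRegime δ r ε μ₁ μ₂ →
      ∀ᶠ n : ℕ in Filter.atTop,
        MixtureDetection.secondKindError
            (MixtureDetection.mixture MixtureDetection.gaussDensity (ε n) (μ₁ n) (μ₂ n))
            (MixtureDetection.orderTest MixtureDetection.gaussDensity n α) ≤ β ∧
        MixtureDetection.secondKindError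
            (MixtureDetection.mixture MixtureDetection.gaussDensity (ε n) (μ₁ n) (μ₂ n))
            (MixtureDetection.varTest MixtureDetection.gaussDensity n α) ≤ β) ∧
    -- above the boundary no level-α test does
    (1 / 4 - δ / 2 < r → ∀ ε μ₁ μ₂ : ℕ → ℝ, MixtureDetection.DenseRegime δ r ε μ₁ μ₂ →
      ∀ᶠ n : ℕ in Filter.atTop, ∀ T : (Fin n → ℝ) → Fin 2,
        MixtureDetection.IsLevelTest MixtureDetection.gaussDensity n α T →
        β < MixtureDetection.secondKindError
            (MixtureDetection.mixture MixtureDetection.gaussDensity (ε n) (μ₁ n) (μ₂ n)) T) :=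
  ⟨fun _ hn => ⟨MixtureDetection.isLevelTest_orderTest hn hα,
      MixtureDetection.isLevelTest_varTest _ hα.1⟩,
    fun hb _ _ _ h => h.eventually_secondKindError_le hδ.1 hr.1 hb hα hβ.1,
    fun hb _ _ _ h => h.eventually_lt_secondKindError hr.1 hb hβ.2⟩
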